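/- **Theorem 7.1 (Joyal–Kock).** Every braided monoidal category arises, up to braided monoidal equivalence, as $\operatorname{End}(I)$ for a weak unit $I$ in an otherwise completely strict monoidal $2$-category. In detail: A *strict $2$-category with strict tensor product* is a strict $2$-category $\mathscr C$ with a strict $2$-functor $\otimes:\mathscr C\times\mathscr C\to\mathscr C$ that is strictly associative on objects, arrows and $2$-cells. A *weak unit* in it (in the sense of Gordon–Power–Street) consists of an object $I$; pseudo-natural transformations with components $\lambda_X:I\otimes X\to X$ and $\rho_X:X\otimes I\to X$, all of which are equivalences (admit pseudo-inverses); and invertible modifications $$K_{X,Y}:\rho_X\otimes Y\Rightarrow X\otimes\lambda_Y,\qquad \Lambda_{X,Y}:\lambda_{X\otimes Y}\Rightarrow\lambda_X\otimes Y,\qquad P_{X,Y}:\rho_{X\otimes Y}\Rightarrow X\otimes\rho_Y$$ satisfying, for all $X,Y,Z$ (vertical composition, the right-hand factor first), the two normalisation axioms $$(X\otimes\Lambda_{Y,Z})\cdot K_{X,Y\otimes Z}=K_{X,Y}\otimes Z,\qquad (X\otimes K_{Y,Z})\cdot(P_{X,Y}\otimes Z)=K_{X\otimes Y,Z}.$$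 Given a weak unit, put $\alpha:=\lambda_I:I\otimes I\to I$ and let $\kappa:\rho_I\Rightarrow\lambda_I$ be the canonical invertible $2$-cell, i.e. the one for which $\lambda_I\circ(\kappa\otimes I)$ is the composite $$\lambda_I\circ(\rho_I\otimes I)\overset{K_{I,I}}{\Longrightarrow}\lambda_I\circ(I\otimes\lambda_I)\Longrightarrow\lambda_I\circ\lambda_{I\otimes I}\overset{\Lambda_{I,I}}{\Longrightarrow}\lambda_I\circ(\lambda_I\otimes I),$$ whose middle $2$-cell is the naturality of $\lambda$ at $\lambda_I$. Let $\operatorname{End}(I)$ be the category of arrows $I\to I$ and $2$-cells between them, with composition of arrows as (strict) tensor product (the product of $f$ and $g$ being $g\circ f$, first $f$ and then $g$). Its canonical braiding $g\circ f\Rightarrow f\circ g$ is the unique $2$-cell whose whiskering with $\alpha$ is $$g\circ f\circ\alpha\Rightarrow g\circ\alpha\circ(I\otimes f)\Rightarrow\alpha\circ(g\otimes I)\circ(I\otimes f)=\alpha\circ(I\otimes f)\circ(g\otimes I)\Rightarrow f\circ\alpha\circ(g\otimes I)\Rightarrow f\circ g\circ\alpha,$$ where $f$ passes through $\alpha$ by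 the naturality $2$-cell of $\lambda$ at $f$, $g$ passes through $\alpha$ by the naturality $2$-cell of $\rho$ at $g$ conjugated by $\kappa$, and the equality is strict interchange. *Claim.* For every braided monoidal category $\mathscr B$ there exist a strict $2$-category $\mathscr C$ with strict tensor product and a weak unit in $\mathscr C$, with object $I$, such that the canonical $2$-cells above form a braiding on the monoidal category $\operatorname{End}(I)$, and there is a braided (strong) monoidal functor $\mathscr B\to\operatorname{End}(I)$ that is an equivalence of categories. -/

import Mathlib

open CategoryTheory Bicategory

universe w v u

/-- The value of a strict 2-functor `F : C × C → C` on a pair of objects. -/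
abbrev pairObj {C : Type u} [Bicategory.{w, v} C] (F : StrictPseudofunctor (C × C) C)
    (X Y : C) : C :=
  F.obj (X, Y)

/-- The value of a strict 2-functor `F : C × C → C` on a pair of arrows. -/
abbrev pairMap {C : Type u} [Bicategory.{w, v} C] (F : StrictPseudofunctor (C × C) C)
    {X X' Y Y' : C} (f : X ⟶ X') (g : Y ⟶ Y') : pairObj F X Y ⟶ pairObj F X' Y' :=
  F.map (Prod.mkHom f g)

/-- The value of a strict 2-functor `F : C × C → C` on a pair of 2-cells. -/
abbrev pairMap₂ {C : Type u} [Bicategory.{w, v} C] (F : StrictPseudofunctor (C × C) C)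
    {X X' Y Y' : C} {f f' : X ⟶ X'} {g g' : Y ⟶ Y'} (φ : f ⟶ f') (ψ : g ⟶ g') :
    pairMap F f g ⟶ pairMap F f' g' :=
  F.map₂ (a := (X, Y)) (b := (X', Y')) (f := Prod.mkHom f g) (g := Prod.mkHom f' g')
    (Prod.mkHom φ ψ)

/-- A strictly associative tensor product on a strict 2-category `C`: a strict 2-functor
`C × C → C` which is associative on the nose on objects, on arrows and on 2-cells.
No unit is part of this structure. -/
structure StrictTensor (C : Type u) [Bicategory.{w, v} C] [Bicategory.Strict C] where
  /-- the tensor product 2-functor -/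
  functor : StrictPseudofunctor (C × C) C
  obj_assoc (X Y Z : C) :
    pairObj functor (pairObj functor X Y) Z = pairObj functor X (pairObj functor Y Z)
  map_assoc {X X' Y Y' Z Z' : C} (f : X ⟶ X') (g : Y ⟶ Y') (h : Z ⟶ Z') :
    HEq (pairMap functor (pairMap functor f g) h)
      (pairMap functor f (pairMap functor g h))
  map₂_assoc {X X' Y Y' Z Z' : C} {f f' : X ⟶ X'} {g g' : Y ⟶ Y'} {h h' : Z ⟶ Z'}
    (φ : f ⟶ f') (ψ : g ⟶ g') (χ : h ⟶ h') :
    HEq (pairMap₂ functor (pairMap₂ functor φ ψ) χ)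
      (pairMap₂ functor φ (pairMap₂ functor ψ χ))

/-- The 2-cells of `C`, with varying boundary. Equality in this type includes equality of the
boundaries, so that it does not depend on how tensor products are bracketed. -/
structure TwoCell (C : Type u) [Bicategory.{w, v} C] where
  /-- source object -/
  {dom : C}
  /-- target object -/
  {cod : C}
  /-- source arrow -/
  {src : dom ⟶ cod}
  /-- target arrow -/
  {tgt : dom ⟶ cod}
  /-- the 2-cell -/
  cell : src ⟶ tgt

/-- `TwoCell.Comp p q r`: the 2-cells `p` and `q` (in this order) are vertically composable, and
`r` is their composite. -/
inductive TwoCell.Comp {C : Type u} [Bicategory.{w, v} C] :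
    TwoCell C → TwoCell C → TwoCell C → Prop
  | mk {X Y : C} {f g h : X ⟶ Y} (φ : f ⟶ g) (ψ : g ⟶ h) :
      TwoCell.Comp ⟨φ⟩ ⟨ψ⟩ ⟨φ ≫ ψ⟩

/-- `TwoCell.Square p q p' q'`: both vertical composites exist and `p` followed by `q` equals `p'`
followed by `q'`. -/
def TwoCell.Square {C : Type u} [Bicategory.{w, v} C] (p q p' q' : TwoCell C) : Prop :=
  ∃ r, TwoCell.Comp p q r ∧ TwoCell.Comp p' q' r

/-- An arrow of a 2-category is an equimorphism if it admits a pseudo-inverse. -/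
def IsEquimorphism {C : Type u} [Bicategory.{w, v} C] {X Y : C} (f : X ⟶ Y) : Prop :=
  ∃ g : Y ⟶ X, Nonempty (𝟙 X ≅ f ≫ g) ∧ Nonempty (g ≫ f ≅ 𝟙 Y)

namespace StrictTensor

variable {C : Type u} [Bicategory.{w, v} C] [Bicategory.Strict C] (T : StrictTensor C)

/-- The tensor product of objects. -/
abbrev obj (X Y : C) : C := pairObj T.functor X Y

/-- The tensor product of arrows. -/
abbrev map {X X' Y Y' : C} (f : X ⟶ X') (g : Y ⟶ Y') : T.obj X Y ⟶ T.obj X' Y' :=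
  pairMap T.functor f g

/-- The tensor product of 2-cells. -/
abbrev map₂ {X X' Y Y' : C} {f f' : X ⟶ X'} {g g' : Y ⟶ Y'} (φ : f ⟶ f') (ψ : g ⟶ g') :
    T.map f g ⟶ T.map f' g' :=
  pairMap₂ T.functor φ ψ

/-- The identification `(X ⊗ Y) ⊗ Z = X ⊗ (Y ⊗ Z)`, as an arrow. -/
abbrev assoc (X Y Z : C) : T.obj (T.obj X Y) Z ⟶ T.obj X (T.obj Y Z) :=
  eqToHom (T.obj_assoc X Y Z)

/-- Tensoring with `A` from the left, `X ↦ A ⊗ X`. -/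
abbrev tensorLeft (A : C) : Pseudofunctor C C :=
  (Bicategory.Prod.sectR A C).toPseudofunctor.comp T.functor.toPseudofunctor

/-- Tensoring with `A` from the right, `X ↦ X ⊗ A`. -/
abbrev tensorRight (A : C) : Pseudofunctor C C :=
  (Bicategory.Prod.sectL C A).toPseudofunctor.comp T.functor.toPseudofunctor

theorem interchange {X X' Y Y' : C} (f : X ⟶ X') (g : Y ⟶ Y') :
    T.map (𝟙 X) g ≫ T.map f (𝟙 Y') = T.map f (𝟙 Y) ≫ T.map (𝟙 X') g := by
  have h₁ := T.functor.map_comp (Prod.mkHom (𝟙 X) g) (Prod.mkHom f (𝟙 Y'))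
  have h₂ := T.functor.map_comp (Prod.mkHom f (𝟙 Y)) (Prod.mkHom (𝟙 X') g)
  refine h₁.symm.trans (Eq.trans ?_ h₂)
  congr 1
  ext
  · exact (Bicategory.Strict.id_comp f).trans (Bicategory.Strict.comp_id f).symm
  · exact (Bicategory.Strict.comp_id g).trans (Bicategory.Strict.id_comp g).symm

end StrictTensor

/-- A weak unit for a strictly associative tensor product `⊗` on a strict 2-category: the unit
data and axioms of a (one-object, locally strict) tricategory whose composition is strict. -/
structure WeakUnit {C : Type u} [Bicategory.{w, v} C] [Bicategory.Strict C]
    (T : StrictTensor C) where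
  /-- the unit object `I` -/
  unit : C
  /-- the left constraints `λ_X : I ⊗ X ⟶ X`, pseudo-natural in `X` -/
  left : Pseudofunctor.StrongTrans (T.tensorLeft unit) (Pseudofunctor.id C)
  left_equi (X : C) : IsEquimorphism (left.app X)
  /-- the right constraints `ρ_X : X ⊗ I ⟶ X`, pseudo-natural in `X` -/
  right : Pseudofunctor.StrongTrans (T.tensorRight unit) (Pseudofunctor.id C)
  right_equi (X : C) : IsEquimorphism (right.app X)
  /-- the middle (Kelly) 2-cells `K : ρ_X ⊗ Y ⇒ X ⊗ λ_Y` -/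
  kelly (X Y : C) :
    T.map (right.app X) (𝟙 Y) ≅ T.assoc X unit Y ≫ T.map (𝟙 X) (left.app Y)
  /-- the left 2-cells `λ_{X ⊗ Y} ⇒ λ_X ⊗ Y` -/
  leftCell (X Y : C) :
    T.assoc unit X Y ≫ left.app (T.obj X Y) ≅ T.map (left.app X) (𝟙 Y)
  /-- the right 2-cells `ρ_{X ⊗ Y} ⇒ X ⊗ ρ_Y` -/
  rightCell (X Y : C) :
    right.app (T.obj X Y) ≅ T.assoc X Y unit ≫ T.map (𝟙 X) (right.app Y)
  /-- the 2-cells `kelly` form a modification -/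
  kelly_natural {X X' Y Y' : C} (f : X ⟶ X') (g : Y ⟶ Y') :
    TwoCell.Square
      ⟨T.map₂ (right.naturality f).hom (𝟙 g)⟩
      ⟨(kelly X Y).hom ▷ T.map f g⟩
      ⟨T.map (T.map f (𝟙 unit)) g ◁ (kelly X' Y').hom⟩
      ⟨T.map₂ (𝟙 f) (left.naturality g).hom⟩
  /-- the 2-cells `leftCell` form a modification -/
  leftCell_natural {X X' Y Y' : C} (f : X ⟶ X') (g : Y ⟶ Y') :
    TwoCell.Square
      ⟨(left.naturality (T.map f g)).hom⟩
      ⟨(leftCell X Y).hom ▷ T.map f g⟩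
      ⟨T.map (T.map (𝟙 unit) f) g ◁ (leftCell X' Y').hom⟩
      ⟨T.map₂ (left.naturality f).hom (𝟙 g)⟩
  /-- the 2-cells `rightCell` form a modification -/
  rightCell_natural {X X' Y Y' : C} (f : X ⟶ X') (g : Y ⟶ Y') :
    TwoCell.Square
      ⟨(right.naturality (T.map f g)).hom⟩
      ⟨(rightCell X Y).hom ▷ T.map f g⟩
      ⟨T.map (T.map f g) (𝟙 unit) ◁ (rightCell X' Y').hom⟩
      ⟨T.map₂ (𝟙 f) (right.naturality g).hom⟩
  /-- left normalised 4-cocycle condition, on `X ⊗ I ⊗ Y ⊗ Z`: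
  `ρ_X ⊗ Y ⊗ Z ⇒ X ⊗ λ_{Y ⊗ Z} ⇒ X ⊗ λ_Y ⊗ Z` is `K_{X,Y} ⊗ Z` -/
  left_normalised (X Y Z : C) :
    TwoCell.Comp
      ⟨(kelly X (T.obj Y Z)).hom⟩
      ⟨T.map₂ (𝟙 (𝟙 X)) (leftCell Y Z).hom⟩
      ⟨T.map₂ (kelly X Y).hom (𝟙 (𝟙 Z))⟩
  /-- right normalised 4-cocycle condition, on `X ⊗ Y ⊗ I ⊗ Z`:
  `ρ_{X ⊗ Y} ⊗ Z ⇒ X ⊗ ρ_Y ⊗ Z ⇒ X ⊗ Y ⊗ λ_Z` is `K_{X ⊗ Y,Z}` -/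
  right_normalised (X Y Z : C) :
    TwoCell.Comp
      ⟨T.map₂ (rightCell X Y).hom (𝟙 (𝟙 Z))⟩
      ⟨T.map₂ (𝟙 (𝟙 X)) (kelly Y Z).hom⟩
      ⟨(kelly (T.obj X Y) Z).hom⟩

namespace WeakUnit

variable {C : Type u} [Bicategory.{w, v} C] [Bicategory.Strict C] {T : StrictTensor C}
  (W : WeakUnit T)

/-- The arrow `α = λ_I : I ⊗ I ⟶ I`. -/
abbrev alpha : T.obj W.unit W.unit ⟶ W.unit := W.left.app W.unit

/-- The invertible 2-cell `κ : ρ_I ⇒ λ_I` is the canonical one: tensored with `I` from the right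
and followed by `λ_I`, it is the composite
`(ρ_I ⊗ I) ≫ λ_I ⇒ (I ⊗ λ_I) ≫ λ_I ⇒ λ_{I ⊗ I} ≫ λ_I ⇒ (λ_I ⊗ I) ≫ λ_I`
of the Kelly 2-cell, the naturality of `λ` at the arrow `λ_I`, and the left 2-cell. Since `λ_I`
is an equimorphism and tensoring with `I` is locally fully faithful, this determines `κ`. -/
def IsCanonicalKappa (κ : W.right.app W.unit ≅ W.alpha) : Prop :=
  T.map₂ κ.hom (𝟙 (𝟙 W.unit)) ▷ W.alpha =
    (W.kelly W.unit W.unit).hom ▷ W.alpha ≫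
      (α_ _ _ _).hom ≫
      T.assoc W.unit W.unit W.unit ◁ (W.left.naturality W.alpha).hom ≫
      (α_ _ _ _).inv ≫
      (W.leftCell W.unit W.unit).hom ▷ W.alpha

/-- An endo-arrow `f` of `I` passes through `α` from the right-hand strand:
`(I ⊗ f) ≫ α ≅ α ≫ f`. -/
abbrev rightStrand (f : W.unit ⟶ W.unit) :
    T.map (𝟙 W.unit) f ≫ W.alpha ≅ W.alpha ≫ f :=
  W.left.naturality f

/-- An endo-arrow `g` of `I` passes through `α` from the left-hand strand:
`(g ⊗ I) ≫ α ≅ α ≫ g`. -/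
abbrev leftStrand (κ : W.right.app W.unit ≅ W.alpha) (g : W.unit ⟶ W.unit) :
    T.map g (𝟙 W.unit) ≫ W.alpha ≅ W.alpha ≫ g :=
  whiskerLeftIso (T.map g (𝟙 W.unit)) κ.symm ≪≫ W.right.naturality g ≪≫ whiskerRightIso κ g

/-- The 2-cell `α ≫ f ≫ g ⇒ α ≫ g ≫ f` obtained by moving `f` into the right-hand strand and
`g` into the left-hand strand, where they move past each other by strict interchange, and moving
them out of the strands again. -/
def exchange (κ : W.right.app W.unit ≅ W.alpha) (f g : W.unit ⟶ W.unit) :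
    W.alpha ≫ f ≫ g ≅ W.alpha ≫ g ≫ f :=
  (α_ _ _ _).symm ≪≫
    whiskerRightIso (W.rightStrand f).symm g ≪≫
    α_ _ _ _ ≪≫
    whiskerLeftIso (T.map (𝟙 W.unit) f) (W.leftStrand κ g).symm ≪≫
    (α_ _ _ _).symm ≪≫
    whiskerRightIso (eqToIso (T.interchange g f)) W.alpha ≪≫
    α_ _ _ _ ≪≫
    whiskerLeftIso (T.map g (𝟙 W.unit)) (W.rightStrand f) ≪≫
    (α_ _ _ _).symm ≪≫
    whiskerRightIso (W.leftStrand κ g) f ≪≫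
    α_ _ _ _

/-- A braiding on the monoidal category `End(I)` (arrows `I ⟶ I` and their 2-cells, with
composition of arrows as tensor product) is the canonical one if the component at `(f, g)` is the
2-cell `f ≫ g ⇒ g ≫ f` whose whiskering with `α` is `exchange`. As `α` is an equimorphism, this
determines the braiding. -/
def IsCanonicalBraiding (β : BraidedCategory (EndMonoidal W.unit)) : Prop :=
  ∃ κ : W.right.app W.unit ≅ W.alpha, W.IsCanonicalKappa κ ∧
    ∀ f g : W.unit ⟶ W.unit, W.alpha ◁ (β.braiding f g).hom = (W.exchange κ f g).hom

end WeakUnit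

/-! The braiding of `B` is built into the composition of arrows, so that interchange can be strict.
Objects are rows of n ≥ 1 strands. An arrow from m to n strands is a word in objects of `B`, m
inputs and n outputs, read from left to right; the outputs cut it into n consecutive blocks.
Composition substitutes the blocks of the first word for the inputs of the second, and the tensor
product is concatenation. On words both are strictly associative, and they satisfy interchange on
the nose (`comp_assoc`, `comp_append`). A 2-cell is a morphism of `B` between the tensor products of
the labels (`realize`), so every hom-category is equivalent to `B`.

To whisker and tensor 2-cells, `realize f ⊗ realize g` is compared with the realization of the
concatenation by `appendIso`, which uses no braiding, and with that of the composite by `compIso`,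
which braids labels of `f` past the labels of `g` that come to stand before them. The 2-category and
its tensor product rest on three coherence facts: `appendIso_assoc`, `compIso_assoc` and
`compIso_append`. The last contains the braiding of the two middle factors.

Words without labels ("plain") realize to the unit object. The constraints λ and ρ merge the extra
strand with its neighbour and are plain. All structural 2-cells of the weak unit are carried by
identities of `B` (`IsCast`); parallel cells of this kind coincide, so the axioms reduce to checking
that the cells involved are of this kind.

The Eckmann–Hilton exchange is not of this kind. As words, `I ⊗ f` followed by `g ⊗ I` and `g ⊗ I`
followed by `I ⊗ f` are both `g ⊗ f`, but the comparison of the first contains the braiding and that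
of the second does not (`compIso_right_left`, `compIso_left_right`). Hence the canonical braiding of
End(I) is carried by the braiding of `B`. Realization is then a braided monoidal equivalence from
End(I) to `B`, and its inverse is the functor sought. -/

/-! ### Words and their composition by substitution -/

/-- The letters of a planar diagram read as a process: an object of `B`, the consumption of an
input strand, or the completion of an output strand. -/
inductive Letter (B : Type u) : Type u
  | label (b : B)
  | input
  | output

namespace Letter

variable {B : Type u}

/-- Run `f` until it completes an output strand, then continue with `k`. -/
def feed (g : List (Letter B)) (k : List (Letter B) → List (Letter B)) :
    List (Letter B) → List (Letter B)
  -- An exhausted word acts as the identity on further strands. With this default, `[]` is a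
  -- two-sided unit and associativity needs no typing hypothesis.
  | [] => input :: g
  | label b :: f => label b :: feed g k f
  | input :: f => input :: feed g k f
  | output :: f => k f

/-- The composite of the word `f` followed by the word `g`: the word `g` in which every input
strand is replaced by the corresponding block of `f`. -/
def comp (f : List (Letter B)) : List (Letter B) → List (Letter B)
  | [] => f
  | label b :: g => label b :: comp f g
  | output :: g => output :: comp f g
  | input :: g => feed g (fun f' => comp f' g) f

@[simp] theorem comp_nil (f : List (Letter B)) : comp f [] = f := rfl
@[simp] theorem comp_label (f g : List (Letter B)) (b : B) :
    comp f (label b :: g) = label b :: comp f g := rfl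
@[simp] theorem comp_output (f g : List (Letter B)) :
    comp f (output :: g) = output :: comp f g := rfl
@[simp] theorem nil_comp_input (g : List (Letter B)) : comp [] (input :: g) = input :: g := rfl
@[simp] theorem label_comp_input (f g : List (Letter B)) (b : B) :
    comp (label b :: f) (input :: g) = label b :: comp f (input :: g) := rfl
@[simp] theorem input_comp_input (f g : List (Letter B)) :
    comp (input :: f) (input :: g) = input :: comp f (input :: g) := rfl
@[simp] theorem output_comp_input (f g : List (Letter B)) :
    comp (output :: f) (input :: g) = comp f g := rfl

@[simp] theorem nil_comp (g : List (Letter B)) : comp [] g = g := by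
  induction g with
  | nil => rfl
  | cons a g ih => cases a <;> simp [ih]

/-- Both sides substitute `f` into `g` into `h`. The next letter is sought in `h`, which at an input
defers to `g`, which at an input defers to `f`; the nested inductions follow this search. -/
theorem comp_assoc (f g h : List (Letter B)) : comp (comp f g) h = comp f (comp g h) := by
  induction h generalizing f g with
  | nil => rfl
  | cons a h ihh =>
    cases a with
    | label b => simp [ihh]
    | output => simp [ihh]
    | input =>
      induction g generalizing f with
      | nil => simp
      | cons a g ihg =>
        cases a with
        | label b => simp [ihg]
        | output => simp [ihh]
        | input =>
          induction f with
          | nil => simp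
          | cons a f ihf =>
            cases a with
            | label b => simpa using ihf
            | input => simpa using ihf
            | output => simpa using ihg f

/-- `Typed m n w`: the word `w` consumes `m` input strands and completes `n` output strands, and it
ends with the completion of an output strand. -/
inductive Typed : ℕ → ℕ → List (Letter B) → Prop
  | nil : Typed 0 0 []
  -- The index `n + 1` requires an output later in the word, so that every label and every input
  -- belongs to a block.
  | label (b : B) {m n : ℕ} {w : List (Letter B)} :
      Typed m (n + 1) w → Typed m (n + 1) (label b :: w)
  | input {m n : ℕ} {w : List (Letter B)} :
      Typed m (n + 1) w → Typed (m + 1) (n + 1) (input :: w)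
  | output {m n : ℕ} {w : List (Letter B)} : Typed m n w → Typed m (n + 1) (output :: w)

theorem Typed.append {m n m' n' : ℕ} {w w' : List (Letter B)} (h : Typed m n w)
    (h' : Typed m' n' w') : Typed (m + m') (n + n') (w ++ w') := by
  induction h with
  | nil => simpa using h'
  | label b _ ih => rw [Nat.add_right_comm] at ih ⊢; exact .label b ih
  | input _ ih =>
    rw [Nat.add_right_comm] at ih
    rw [Nat.add_right_comm _ 1 m', Nat.add_right_comm _ 1 n']
    exact .input ih
  | output _ ih => rw [Nat.add_right_comm]; exact .output ih

/-- This forces the empty row out of the 2-category: no arrow could lead from one strand to it, so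
it would have no unit constraints. -/
theorem Typed.eq_nil {m : ℕ} {w : List (Letter B)} (h : Typed m 0 w) : m = 0 ∧ w = [] := by
  cases h
  exact ⟨rfl, rfl⟩

theorem Typed.comp {m n p : ℕ} {f g : List (Letter B)} (hf : Typed m n f) (hg : Typed n p g) :
    Typed m p (Letter.comp f g) := by
  induction hg generalizing m f with
  | nil => exact hf
  | label b _ ih => exact .label b (ih hf)
  | output _ ih => exact .output (ih hf)
  | @input n p g _ ih =>
    induction f generalizing m with
    | nil => cases hf
    | cons a f ihf =>
      cases hf with
      | label b h => exact .label b (ihf h)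
      | input h => exact .input (ihf h)
      | output h => exact ih h

/-- Since `g` has as many inputs as `f` has blocks, `f` is used up exactly when `g` ends, and
nothing of `f` spills over into `g'`. This is strict interchange for words. -/
theorem comp_append {m n p : ℕ} {f g : List (Letter B)} (hf : Typed m n f) (hg : Typed n p g)
    (f' g' : List (Letter B)) : comp (f ++ f') (g ++ g') = comp f g ++ comp f' g' := by
  induction hg generalizing m f with
  | nil => obtain ⟨-, rfl⟩ := hf.eq_nil; rfl
  | label b _ ih => simp [ih hf]
  | output _ ih => simp [ih hf]
  | @input n p g _ ih =>
    induction f generalizing m with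
    | nil => cases hf
    | cons a f ihf =>
      cases hf with
      | label b h => simpa using ihf h
      | input h => simpa using ihf h
      | output h => simpa using ih h

/-- The word of `n` parallel strands without labels. -/
def strands : ℕ → List (Letter B)
  | 0 => []
  | n + 1 => input :: output :: strands n

theorem typed_strands (n : ℕ) : Typed n n (strands n : List (Letter B)) := by
  induction n with
  | zero => exact .nil
  | succ n ih => exact .input (.output ih)

theorem strands_add (m n : ℕ) :
    (strands (m + n) : List (Letter B)) = strands m ++ strands n := by
  induction m with
  | zero => simp [strands]
  | succ m ih => rw [Nat.add_right_comm]; simp [strands, ih]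

theorem comp_strands {m n : ℕ} {f : List (Letter B)} (hf : Typed m n f) :
    comp f (strands n) = f := by
  induction hf with
  | nil => rfl
  | label b _ ih => simpa [strands] using ih
  | input _ ih => simpa [strands] using ih
  | output _ ih => simpa [strands] using ih

theorem strands_comp {m n : ℕ} {f : List (Letter B)} (hf : Typed m n f) :
    comp (strands m) f = f := by
  induction hf with
  | nil => rfl
  | label b _ ih => simpa using ih
  | input _ ih => simpa [strands] using ih
  | output _ ih => simpa using ih

/-- The word `w` carries no labels. -/
inductive Plain : List (Letter B) → Prop
  | nil : Plain []
  | input {w : List (Letter B)} : Plain w → Plain (input :: w)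
  | output {w : List (Letter B)} : Plain w → Plain (output :: w)

theorem Plain.append {w w' : List (Letter B)} (h : Plain w) (h' : Plain w') :
    Plain (w ++ w') := by
  induction h with
  | nil => exact h'
  | input _ ih => exact .input ih
  | output _ ih => exact .output ih

theorem plain_strands (n : ℕ) : Plain (strands n : List (Letter B)) := by
  induction n with
  | zero => exact .nil
  | succ n ih => exact .input (.output ih)

theorem Plain.comp {f g : List (Letter B)} (hf : Plain f) (hg : Plain g) :
    Plain (Letter.comp f g) := by
  induction hg generalizing f with
  | nil => exact hf
  | output _ ih => exact .output (ih hf)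
  | input hg ih =>
    induction hf with
    | nil => exact .input hg
    | input _ ih => exact .input ih
    | output h _ => exact ih h

end Letter

/-! ### Realization of words and of their concatenations -/

namespace CategoryTheory

section HEqCalculus

variable {B : Type u} [Category.{v} B]

theorem comp_heq_comp {X X' Y Y' Z Z' : B} {f : X ⟶ Y} {f' : X' ⟶ Y'} {g : Y ⟶ Z} {g' : Y' ⟶ Z'}
    (hX : X = X') (hY : Y = Y') (hZ : Z = Z') (hf : f ≍ f') (hg : g ≍ g') : f ≫ g ≍ f' ≫ g' := by
  subst hX hY hZ hf hg; rfl

variable [MonoidalCategory B]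
open MonoidalCategory

theorem whiskerLeft_heq_whiskerLeft {W W' X X' Y Y' : B} {f : X ⟶ Y} {f' : X' ⟶ Y'} (hW : W = W')
    (hX : X = X') (hY : Y = Y') (hf : f ≍ f') : W ◁ f ≍ W' ◁ f' := by
  subst hW hX hY hf; rfl

end HEqCalculus

end CategoryTheory

namespace Letter

open MonoidalCategory

section Realize

variable {B : Type u} [Category.{v} B] [MonoidalCategory B]

/-- The tensor product of the labels of a word. -/
def realize : List (Letter B) → B
  | [] => 𝟙_ B
  | label b :: w => b ⊗ realize w
  | input :: w => realize w
  | output :: w => realize w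

/-- The list of labels of a word. -/
def labels {B : Type u} : List (Letter B) → List B
  | [] => []
  | label b :: w => b :: labels w
  | input :: w => labels w
  | output :: w => labels w

/-- The positions of inputs and outputs do not matter: `realize` is a right-bracketed product over
the list of labels. The equality is one of objects, so such words can be compared by `eqToHom`. -/
theorem realize_congr {f : List (Letter B)} : {g : List (Letter B)} → labels f = labels g →
    realize f = realize g := by
  suffices h : ∀ w : List (Letter B), realize w = (labels w).foldr (· ⊗ ·) (𝟙_ B) by
    intro g e; rw [h, h, e]
  intro w
  induction w with
  | nil => rfl
  | cons a w ih =>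
    cases a with
    | label b => exact congrArg (b ⊗ ·) ih
    | input => exact ih
    | output => exact ih

theorem Plain.labels_eq {B : Type u} {p : List (Letter B)} (hp : Plain p) : labels p = [] := by
  induction hp with
  | nil => rfl
  | input _ ih => exact ih
  | output _ ih => exact ih

theorem labels_append {B : Type u} (f g : List (Letter B)) :
    labels (f ++ g) = labels f ++ labels g := by
  induction f with
  | nil => rfl
  | cons a f ih => cases a <;> simp [labels, ih]

theorem labels_comp_plain {B : Type u} (f : List (Letter B)) {p : List (Letter B)}
    (hp : Plain p) : labels (comp f p) = labels f := by
  induction hp generalizing f with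
  | nil => rfl
  | output _ ih => exact ih f
  | @input p hp ih =>
    induction f with
    | nil => exact hp.labels_eq
    | cons a f ihf =>
      cases a with
      | label b => exact congrArg (b :: ·) ihf
      | input => exact ihf
      | output => exact ih f

theorem labels_plain_comp {B : Type u} {p : List (Letter B)} (hp : Plain p)
    (f : List (Letter B)) : labels (comp p f) = labels f := by
  induction f generalizing p with
  | nil => exact hp.labels_eq
  | cons a f ihf =>
    cases a with
    | label b => exact congrArg (b :: ·) (ihf hp)
    | output => exact ihf hp
    | input =>
      induction hp with
      | nil => rfl
      | input _ ih => exact ih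
      | output h _ => exact ihf h

theorem labels_append_plain {B : Type u} (f : List (Letter B)) {p : List (Letter B)}
    (hp : Plain p) : labels (f ++ p) = labels f := by
  rw [labels_append, hp.labels_eq, List.append_nil]

theorem labels_plain_append {B : Type u} {p : List (Letter B)} (hp : Plain p)
    (f : List (Letter B)) : labels (p ++ f) = labels f := by
  rw [labels_append, hp.labels_eq, List.nil_append]

theorem Plain.realize_eq {p : List (Letter B)} (hp : Plain p) : realize p = 𝟙_ B :=
  realize_congr (g := []) hp.labels_eq

theorem realize_comp_plain (f : List (Letter B)) {p : List (Letter B)} (hp : Plain p) :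
    realize (comp f p) = realize f :=
  realize_congr (labels_comp_plain f hp)

theorem realize_plain_comp {p : List (Letter B)} (hp : Plain p) (f : List (Letter B)) :
    realize (comp p f) = realize f :=
  realize_congr (labels_plain_comp hp f)

theorem realize_append_plain (f : List (Letter B)) {p : List (Letter B)} (hp : Plain p) :
    realize (f ++ p) = realize f :=
  realize_congr (labels_append_plain f hp)

theorem realize_plain_append {p : List (Letter B)} (hp : Plain p) (f : List (Letter B)) :
    realize (p ++ f) = realize f :=
  realize_congr (labels_plain_append hp f)

/-- The realization of a concatenation of words. -/
def appendIso : (f g : List (Letter B)) → (realize f ⊗ realize g ≅ realize (f ++ g))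
  | [], g => λ_ (realize g)
  | label b :: f, g => α_ b (realize f) (realize g) ≪≫ whiskerLeftIso b (appendIso f g)
  | input :: f, g => appendIso f g
  | output :: f, g => appendIso f g

/-- Heterogeneous equality is needed because the targets agree only through associativity of
concatenation. Each label contributes one pentagon. -/
theorem appendIso_assoc (f g h : List (Letter B)) :
    (appendIso f g).hom ▷ realize h ≫ (appendIso (f ++ g) h).hom ≍
      (α_ (realize f) (realize g) (realize h)).hom ≫
        realize f ◁ (appendIso g h).hom ≫ (appendIso f (g ++ h)).hom := by
  induction f with
  | nil =>
    apply heq_of_eq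
    change (λ_ (realize g)).hom ▷ realize h ≫ (appendIso g h).hom =
      (α_ (𝟙_ B) (realize g) (realize h)).hom ≫ 𝟙_ B ◁ (appendIso g h).hom ≫
        (λ_ (realize (g ++ h))).hom
    simp
  | cons a f ih =>
    cases a with
    | input => exact ih
    | output => exact ih
    | label b =>
      have h₁ : (appendIso (label b :: f) g).hom ▷ realize h ≫
          (appendIso (label b :: f ++ g) h).hom =
          ((α_ b (realize f) (realize g)).hom ▷ realize h ≫ (α_ b _ (realize h)).hom) ≫
            b ◁ ((appendIso f g).hom ▷ realize h ≫ (appendIso (f ++ g) h).hom) := by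
        change ((α_ b (realize f) (realize g)).hom ≫ b ◁ (appendIso f g).hom) ▷ realize h ≫
          (α_ b (realize (f ++ g)) (realize h)).hom ≫ b ◁ (appendIso (f ++ g) h).hom = _
        simp
      have h₂ : (α_ (realize (label b :: f)) (realize g) (realize h)).hom ≫
          realize (label b :: f) ◁ (appendIso g h).hom ≫
            (appendIso (label b :: f) (g ++ h)).hom =
          ((α_ b (realize f) (realize g)).hom ▷ realize h ≫ (α_ b _ (realize h)).hom) ≫
            b ◁ ((α_ (realize f) (realize g) (realize h)).hom ≫
        realize f ◁ (appendIso g h).hom ≫ (appendIso f (g ++ h)).hom) := by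
        change (α_ (b ⊗ realize f) (realize g) (realize h)).hom ≫
          (b ⊗ realize f) ◁ (appendIso g h).hom ≫
            (α_ b (realize f) (realize (g ++ h))).hom ≫ b ◁ (appendIso f (g ++ h)).hom = _
        simp
      rw [h₁, h₂]
      refine comp_heq_comp rfl rfl ?_ HEq.rfl (whiskerLeft_heq_whiskerLeft rfl rfl ?_ ih)
      · simp
      · simp

theorem labels_map_label {B : Type u} (l : List B) : labels (l.map label) = l := by
  induction l with
  | nil => rfl
  | cons b l ih => exact congrArg (b :: ·) ih

/-- Concatenation never permutes labels, so the comparison ignores the strands; `f` is normalised to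
the word consisting of its labels alone. The analogue for `compIso` fails, as there the strands
decide what is braided. -/
theorem appendIso_heq_map_label (f : List (Letter B)) {g g' : List (Letter B)}
    (hg : labels g = labels g') :
    (appendIso f g).hom ≍ (appendIso ((labels f).map label) g').hom := by
  induction f with
  | nil =>
    change (λ_ (realize g)).hom ≍ (λ_ (realize g')).hom
    rw [realize_congr hg]
  | cons a f ih =>
    cases a with
    | input => exact ih
    | output => exact ih
    | label b =>
      have hf : realize f = realize ((labels f).map label) :=
        realize_congr (labels_map_label _).symm
      have hfg : realize (f ++ g) = realize ((labels f).map label ++ g') :=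
        realize_congr (by rw [labels_append, labels_append, labels_map_label, hg])
      refine comp_heq_comp (Y := b ⊗ (realize f ⊗ realize g))
        (Y' := b ⊗ (realize ((labels f).map label) ⊗ realize g')) ?_ ?_
        (congrArg (b ⊗ ·) hfg) ?_ (whiskerLeft_heq_whiskerLeft rfl ?_ hfg ih)
      · exact congrArg₂ (fun x y => (b ⊗ x) ⊗ y) hf (realize_congr hg)
      · rw [hf, realize_congr hg]
      · change (α_ b (realize f) (realize g)).hom ≍
          (α_ b (realize ((labels f).map label)) (realize g')).hom
        rw [hf, realize_congr hg]
      · rw [hf, realize_congr hg]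

theorem appendIso_heq_appendIso {f f' g g' : List (Letter B)} (hf : labels f = labels f')
    (hg : labels g = labels g') : (appendIso f g).hom ≍ (appendIso f' g').hom := by
  refine (appendIso_heq_map_label f hg).trans ?_
  rw [hf]
  exact (appendIso_heq_map_label f' rfl).symm

theorem appendIso_plain (f : List (Letter B)) {p : List (Letter B)} (hp : Plain p) :
    (appendIso f p).hom ≍ (ρ_ (realize f)).hom := by
  induction f with
  | nil =>
    change (λ_ (realize p)).hom ≍ (ρ_ (𝟙_ B)).hom
    rw [hp.realize_eq, MonoidalCategory.unitors_equal]
  | cons a f ih =>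
    cases a with
    | input => exact ih
    | output => exact ih
    | label b =>
      have : (ρ_ (realize (label b :: f))).hom =
          (α_ b (realize f) (𝟙_ B)).hom ≫ b ◁ (ρ_ (realize f)).hom := by
        simp [realize]
      rw [this]
      refine comp_heq_comp (Y := b ⊗ (realize f ⊗ realize p)) ?_ ?_ ?_ ?_
        (whiskerLeft_heq_whiskerLeft rfl ?_ ?_ ih)
      · rw [hp.realize_eq]; rfl
      · rw [hp.realize_eq]
      · exact realize_append_plain (label b :: f) hp
      · rw [hp.realize_eq]; rfl
      · rw [hp.realize_eq]
      · exact realize_append_plain f hp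

theorem plain_appendIso {p : List (Letter B)} (hp : Plain p) (f : List (Letter B)) :
    (appendIso p f).hom ≍ (λ_ (realize f)).hom := by
  induction hp with
  | nil => rfl
  | input _ ih => exact ih
  | output _ ih => exact ih

/-- Inductive step of `compIso_assoc` for a label that comes from the first word. -/
theorem associator_step_assoc {X Y Z P Q S S' : B} (b : B) {m : X ⊗ Y ⟶ P} {n : Y ⊗ Z ⟶ Q}
    {k : P ⊗ Z ⟶ S} {l : X ⊗ Q ⟶ S'} (hS : S = S')
    (h : m ▷ Z ≫ k ≍ (α_ X Y Z).hom ≫ X ◁ n ≫ l) :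
    ((α_ b X Y).hom ≫ b ◁ m) ▷ Z ≫ (α_ b P Z).hom ≫ b ◁ k ≍
      (α_ (b ⊗ X) Y Z).hom ≫ (b ⊗ X) ◁ n ≫ (α_ b X Q).hom ≫ b ◁ l := by
  subst hS
  apply heq_of_eq
  rw [MonoidalCategory.comp_whiskerRight_assoc,
    MonoidalCategory.associator_naturality_middle_assoc,
    ← MonoidalCategory.whiskerLeft_comp, eq_of_heq h]
  simp

end Realize

/-! ### Sliding an object past a label -/

section Braided

variable {B : Type u} [Category.{v} B] [MonoidalCategory B] [BraidedCategory B]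

/-- Move the object `X` past the object `b` by the braiding. -/
def slide (X b Y : B) : X ⊗ (b ⊗ Y) ≅ b ⊗ (X ⊗ Y) :=
  (α_ X b Y).symm ≪≫ whiskerRightIso (β_ X b) Y ≪≫ α_ b X Y

theorem slide_natural {X X' Y Y' : B} (f : X ⟶ X') (b : B) (g : Y ⟶ Y') :
    (f ⊗ₘ b ◁ g) ≫ (slide X' b Y').hom = (slide X b Y).hom ≫ b ◁ (f ⊗ₘ g) := by
  simp only [slide, Iso.trans_hom, Iso.symm_hom, MonoidalCategory.whiskerRightIso_hom,
    MonoidalCategory.tensorHom_def, MonoidalCategory.whiskerLeft_comp, Category.assoc]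
  rw [MonoidalCategory.associator_inv_naturality_right_assoc,
    MonoidalCategory.whisker_exchange_assoc, MonoidalCategory.associator_naturality_right,
    MonoidalCategory.associator_inv_naturality_left_assoc,
    ← MonoidalCategory.comp_whiskerRight_assoc, BraidedCategory.braiding_naturality_left,
    MonoidalCategory.comp_whiskerRight_assoc, MonoidalCategory.associator_naturality_middle_assoc]

theorem slide_natural_left {X X' : B} (f : X ⟶ X') (b Y : B) :
    f ▷ (b ⊗ Y) ≫ (slide X' b Y).hom = (slide X b Y).hom ≫ b ◁ f ▷ Y := by
  simpa using slide_natural f b (𝟙 Y)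

theorem slide_natural_right (X b : B) {Y Y' : B} (g : Y ⟶ Y') :
    X ◁ b ◁ g ≫ (slide X b Y').hom = (slide X b Y).hom ≫ b ◁ X ◁ g := by
  simpa using slide_natural (𝟙 X) b g

/-- One of the hexagons: sliding a product is sliding its factors one after the other. -/
theorem slide_tensor (X X' b Y : B) :
    (slide (X ⊗ X') b Y).hom ≫ b ◁ (α_ X X' Y).hom =
      (α_ X X' (b ⊗ Y)).hom ≫ X ◁ (slide X' b Y).hom ≫ (slide X b (X' ⊗ Y)).hom := by
  simp only [slide, Iso.trans_hom, Iso.symm_hom, MonoidalCategory.whiskerRightIso_hom,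
    BraidedCategory.braiding_tensor_left_hom]
  monoidal

theorem slide_unit (b Y : B) :
    (slide (𝟙_ B) b Y).hom = (λ_ (b ⊗ Y)).hom ≫ b ◁ (λ_ Y).inv := by
  simp only [slide, Iso.trans_hom, Iso.symm_hom, MonoidalCategory.whiskerRightIso_hom,
    braiding_tensorUnit_left]
  monoidal

theorem slide_assoc (X b Y Z : B) :
    (slide X b Y).hom ▷ Z ≫ (α_ b (X ⊗ Y) Z).hom ≫ b ◁ (α_ X Y Z).hom =
      (α_ X (b ⊗ Y) Z).hom ≫ X ◁ (α_ b Y Z).hom ≫ (slide X b (Y ⊗ Z)).hom := by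
  simp only [slide, Iso.trans_hom, Iso.symm_hom, MonoidalCategory.whiskerRightIso_hom]
  monoidal

/-- The hexagons split the braiding of `X'` past `b ⊗ Y` and that of `X ⊗ X'` past `b`. Both sides
then braid `X'` past `b`, `X` past `b` and `X'` past `Y`, and the last two commute by interchange in
`B`. -/
theorem tensorμ_slide (X X' b Y Y' : B) :
    tensorμ X X' (b ⊗ Y) Y' ≫ (slide X b Y).hom ▷ (X' ⊗ Y') ≫ (α_ b (X ⊗ Y) (X' ⊗ Y')).hom =
      (X ⊗ X') ◁ (α_ b Y Y').hom ≫ (slide (X ⊗ X') b (Y ⊗ Y')).hom ≫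
        b ◁ tensorμ X X' Y Y' := by
  simp only [slide, tensorμ, Iso.trans_hom, Iso.symm_hom, MonoidalCategory.whiskerRightIso_hom,
    BraidedCategory.braiding_tensor_left_hom, BraidedCategory.braiding_tensor_right_hom]
  calc
    _ = 𝟙 _ ⊗≫ X ◁ (β_ X' b).hom ▷ Y ▷ Y' ⊗≫
      ((X ⊗ b) ◁ (β_ X' Y).hom ≫ (β_ X b).hom ▷ (Y ⊗ X')) ▷ Y' ⊗≫ 𝟙 _ := by monoidal
    _ = _ := by rw [MonoidalCategory.whisker_exchange]; monoidal

theorem tensorμ_associator (b X X' Y Y' : B) :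
    tensorμ (b ⊗ X) X' Y Y' ≫ (α_ b X Y).hom ▷ (X' ⊗ Y') ≫ (α_ b (X ⊗ Y) (X' ⊗ Y')).hom =
      (α_ b X X').hom ▷ (Y ⊗ Y') ≫ (α_ b (X ⊗ X') (Y ⊗ Y')).hom ≫ b ◁ tensorμ X X' Y Y' := by
  simp only [tensorμ]
  monoidal

end Braided

end Letter

/-! ### The comparison for composites and its coherence -/

namespace Letter

open MonoidalCategory

variable {B : Type u} [Category.{v} B] [MonoidalCategory B] [BraidedCategory B]

/-- The realization of `feed g k f`, given the realizations of the continuation `k`. -/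
def feedIso (g : List (Letter B)) (k : List (Letter B) → List (Letter B))
    (e : ∀ f, realize f ⊗ realize g ≅ realize (k f)) :
    (f : List (Letter B)) → (realize f ⊗ realize g ≅ realize (feed g k f))
  | [] => λ_ (realize g)
  | label b :: f => α_ b (realize f) (realize g) ≪≫ whiskerLeftIso b (feedIso g k e f)
  | input :: f => feedIso g k e f
  | output :: f => e f

/-- The realization of a composite of words. Labels of `f` are braided past those labels of `g`
which precede them in the composite. -/
def compIso : (f g : List (Letter B)) → (realize f ⊗ realize g ≅ realize (comp f g))
  | f, [] => ρ_ (realize f)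
  | f, label b :: g => slide (realize f) b (realize g) ≪≫ whiskerLeftIso b (compIso f g)
  | f, output :: g => compIso f g
  | f, input :: g => feedIso g (fun f' => comp f' g) (fun f' => compIso f' g) f

theorem compIso_label (f g : List (Letter B)) (b : B) :
    (compIso f (label b :: g)).hom =
      (slide (realize f) b (realize g)).hom ≫ b ◁ (compIso f g).hom := rfl

theorem label_compIso_input (f g : List (Letter B)) (b : B) :
    (compIso (label b :: f) (input :: g)).hom =
      (α_ b (realize f) (realize g)).hom ≫ b ◁ (compIso f (input :: g)).hom := rfl

/-- Only the unit object is slid past the labels of `f`, and braiding with the unit is trivial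
(`slide_unit`). -/
theorem plain_compIso {p : List (Letter B)} (hp : Plain p) (f : List (Letter B)) :
    (compIso p f).hom ≍ (λ_ (realize f)).hom := by
  induction f generalizing p with
  | nil =>
    change (ρ_ (realize p)).hom ≍ (λ_ (𝟙_ B)).hom
    rw [hp.realize_eq, MonoidalCategory.unitors_equal]
  | cons a f ihf =>
    cases a with
    | label b =>
      have : (λ_ (realize (label b :: f))).hom =
          (slide (𝟙_ B) b (realize f)).hom ≫ b ◁ (λ_ (realize f)).hom := by
        rw [slide_unit]; simp [realize]
      rw [this, compIso_label]
      refine comp_heq_comp ?_ ?_ (realize_plain_comp hp (label b :: f)) ?_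
        (whiskerLeft_heq_whiskerLeft rfl ?_ (realize_plain_comp hp f) (ihf hp))
      all_goals rw [hp.realize_eq]
    | output => exact ihf hp
    | input =>
      induction hp with
      | nil => rfl
      | input _ ih => exact ih
      | output h _ => exact ihf h

/-- The second word has no label to slide past, so only associators and unitors occur. -/
theorem compIso_plain (f : List (Letter B)) {p : List (Letter B)} (hp : Plain p) :
    (compIso f p).hom ≍ (ρ_ (realize f)).hom := by
  induction hp generalizing f with
  | nil => rfl
  | output _ ih => exact ih f
  | @input p hp ih =>
    induction f with
    | nil =>
      change (λ_ (realize p)).hom ≍ (ρ_ (𝟙_ B)).hom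
      rw [hp.realize_eq, MonoidalCategory.unitors_equal]
    | cons a f ihf =>
      cases a with
      | label b =>
        have : (ρ_ (realize (label b :: f))).hom =
            (α_ b (realize f) (𝟙_ B)).hom ≫ b ◁ (ρ_ (realize f)).hom := by
          simp [realize]
        rw [this, label_compIso_input]
        refine comp_heq_comp ?_ ?_ (realize_comp_plain (label b :: f) hp.input) ?_
          (whiskerLeft_heq_whiskerLeft rfl ?_ (realize_comp_plain f hp.input) ihf)
        all_goals rw [hp.realize_eq]
      | input => exact ihf
      | output => exact ih f

section Steps

variable {X X' Y Y' Z P P' Q S S' : B}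

/-- Inductive step of `compIso_assoc` for a label of the third word, past which both earlier words
slide. In the next lemma the label belongs to the second word, and only the first word slides. -/
theorem slide_step_assoc (b : B) {m : X ⊗ Y ⟶ P} {n : Y ⊗ Z ⟶ Q} {k : P ⊗ Z ⟶ S} {l : X ⊗ Q ⟶ S'}
    (hS : S = S') (h : m ▷ Z ≫ k ≍ (α_ X Y Z).hom ≫ X ◁ n ≫ l) :
    m ▷ (b ⊗ Z) ≫ (slide P b Z).hom ≫ b ◁ k ≍
      (α_ X Y (b ⊗ Z)).hom ≫ X ◁ ((slide Y b Z).hom ≫ b ◁ n) ≫ (slide X b Q).hom ≫ b ◁ l := by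
  subst hS
  apply heq_of_eq
  rw [reassoc_of% slide_natural_left, ← MonoidalCategory.whiskerLeft_comp, eq_of_heq h]
  simp only [MonoidalCategory.whiskerLeft_comp, Category.assoc]
  rw [reassoc_of% slide_natural_right, reassoc_of% slide_tensor]

theorem slide_associator_step_assoc (b : B) {m : X ⊗ Y ⟶ P} {n : Y ⊗ Z ⟶ Q} {k : P ⊗ Z ⟶ S}
    {l : X ⊗ Q ⟶ S'} (hS : S = S') (h : m ▷ Z ≫ k ≍ (α_ X Y Z).hom ≫ X ◁ n ≫ l) :
    ((slide X b Y).hom ≫ b ◁ m) ▷ Z ≫ (α_ b P Z).hom ≫ b ◁ k ≍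
      (α_ X (b ⊗ Y) Z).hom ≫ X ◁ ((α_ b Y Z).hom ≫ b ◁ n) ≫ (slide X b Q).hom ≫ b ◁ l := by
  subst hS
  apply heq_of_eq
  rw [MonoidalCategory.comp_whiskerRight_assoc,
    MonoidalCategory.associator_naturality_middle_assoc,
    ← MonoidalCategory.whiskerLeft_comp, eq_of_heq h]
  simp only [MonoidalCategory.whiskerLeft_comp, Category.assoc]
  rw [reassoc_of% slide_natural_right, reassoc_of% slide_assoc]

/-- Inductive step of `compIso_append` for a label of `g`, which `f` and `f'` both have to pass. For
a label of `f`, treated next, no braiding beyond `tensorμ` occurs. -/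
theorem slide_step_append (b : B) {m : X ⊗ X' ⟶ P} {n : Y ⊗ Y' ⟶ Q} {k : P ⊗ Q ⟶ S}
    {r : X ⊗ Y ⟶ P'} {s : X' ⊗ Y' ⟶ Z} {l : P' ⊗ Z ⟶ S'} (hS : S = S')
    (h : (m ⊗ₘ n) ≫ k ≍ tensorμ X X' Y Y' ≫ (r ⊗ₘ s) ≫ l) :
    (m ⊗ₘ ((α_ b Y Y').hom ≫ b ◁ n)) ≫ (slide P b Q).hom ≫ b ◁ k ≍
      tensorμ X X' (b ⊗ Y) Y' ≫ (((slide X b Y).hom ≫ b ◁ r) ⊗ₘ s) ≫ (α_ b P' Z).hom ≫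
        b ◁ l := by
  subst hS
  apply heq_of_eq
  have h₁ : m ⊗ₘ ((α_ b Y Y').hom ≫ b ◁ n) = (X ⊗ X') ◁ (α_ b Y Y').hom ≫ (m ⊗ₘ b ◁ n) := by
    rw [← id_tensorHom (X ⊗ X'), tensorHom_comp_tensorHom, Category.id_comp]
  have h₂ : ((slide X b Y).hom ≫ b ◁ r) ⊗ₘ s =
      (slide X b Y).hom ▷ (X' ⊗ Y') ≫ ((b ◁ r) ⊗ₘ s) := by
    rw [← tensorHom_id, tensorHom_comp_tensorHom, Category.id_comp]
  rw [h₁, h₂]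
  simp only [Category.assoc]
  rw [reassoc_of% slide_natural, ← MonoidalCategory.whiskerLeft_comp, eq_of_heq h]
  simp only [MonoidalCategory.whiskerLeft_comp]
  rw [← reassoc_of% tensorμ_slide]
  simp [MonoidalCategory.tensorHom_def]

theorem associator_step_append (b : B) {m : X ⊗ X' ⟶ P} {n : Y ⊗ Y' ⟶ Q} {k : P ⊗ Q ⟶ S}
    {r : X ⊗ Y ⟶ P'} {s : X' ⊗ Y' ⟶ Z} {l : P' ⊗ Z ⟶ S'} (hS : S = S')
    (h : (m ⊗ₘ n) ≫ k ≍ tensorμ X X' Y Y' ≫ (r ⊗ₘ s) ≫ l) :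
    (((α_ b X X').hom ≫ b ◁ m) ⊗ₘ n) ≫ (α_ b P Q).hom ≫ b ◁ k ≍
      tensorμ (b ⊗ X) X' Y Y' ≫ (((α_ b X Y).hom ≫ b ◁ r) ⊗ₘ s) ≫ (α_ b P' Z).hom ≫
        b ◁ l := by
  subst hS
  apply heq_of_eq
  have h₁ : (((α_ b X X').hom ≫ b ◁ m) ⊗ₘ n) ≫ (α_ b P Q).hom =
      (α_ b X X').hom ▷ (Y ⊗ Y') ≫ (α_ b (X ⊗ X') (Y ⊗ Y')).hom ≫ b ◁ (m ⊗ₘ n) := by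
    simp [MonoidalCategory.tensorHom_def]
  rw [reassoc_of% h₁, ← MonoidalCategory.whiskerLeft_comp, eq_of_heq h]
  simp only [MonoidalCategory.whiskerLeft_comp]
  rw [← reassoc_of% tensorμ_associator]
  simp [MonoidalCategory.tensorHom_def]

end Steps

/-- The inductions are those of `comp_assoc`; every label of the composite contributes one of the
three step lemmas, according to the word it comes from. -/
theorem compIso_assoc (f g h : List (Letter B)) :
    (compIso f g).hom ▷ realize h ≫ (compIso (comp f g) h).hom ≍
      (α_ (realize f) (realize g) (realize h)).hom ≫
        realize f ◁ (compIso g h).hom ≫ (compIso f (comp g h)).hom := by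
  have e (f g h : List (Letter B)) : realize (comp (comp f g) h) = realize (comp f (comp g h)) :=
    congrArg realize (comp_assoc f g h)
  induction h generalizing f g with
  | nil =>
    apply heq_of_eq
    change (compIso f g).hom ▷ 𝟙_ B ≫ (ρ_ (realize (comp f g))).hom =
      (α_ (realize f) (realize g) (𝟙_ B)).hom ≫ realize f ◁ (ρ_ (realize g)).hom ≫
        (compIso f g).hom
    simp
  | cons a h ihh =>
    cases a with
    | label b => exact slide_step_assoc b (e f g h) (ihh f g)
    | output => exact ihh f g
    | input =>
      induction g generalizing f with
      | nil =>
        exact heq_of_eq (MonoidalCategory.triangle_assoc (realize f) (realize h)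
          (compIso f (input :: h)).hom).symm
      | cons a g ihg =>
        cases a with
        | label b => exact slide_associator_step_assoc b (e f g (input :: h)) (ihg f)
        | output => exact ihh f g
        | input =>
          induction f with
          | nil =>
            have key {X Y Z : B} (k : X ⊗ Y ⟶ Z) : (λ_ X).hom ▷ Y ≫ k =
                (α_ (𝟙_ B) X Y).hom ≫ 𝟙_ B ◁ k ≫ (λ_ Z).hom := by
              simp
            exact heq_of_eq (key _)
          | cons a f ihf =>
            cases a with
            | label b => exact associator_step_assoc b (e f (input :: g) (input :: h)) ihf
            | input => exact ihf
            | output => exact ihg f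

/-- Composing the concatenations moves `f'` past `g`, whereas composing blockwise does not;
`tensorμ` accounts for the difference. This is the interchange law for 2-cells. -/
theorem compIso_append {m n p : ℕ} {f g : List (Letter B)} (hf : Typed m n f) (hg : Typed n p g)
    (f' g' : List (Letter B)) :
    ((appendIso f f').hom ⊗ₘ (appendIso g g').hom) ≫ (compIso (f ++ f') (g ++ g')).hom ≍
      tensorμ (realize f) (realize f') (realize g) (realize g') ≫
        ((compIso f g).hom ⊗ₘ (compIso f' g').hom) ≫
          (appendIso (comp f g) (comp f' g')).hom := by
  induction hg generalizing m f with
  | nil =>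
    obtain ⟨-, rfl⟩ := hf.eq_nil
    have key {X Y Z : B} (k : X ⊗ Y ⟶ Z) : ((λ_ X).hom ⊗ₘ (λ_ Y).hom) ≫ k =
        tensorμ (𝟙_ B) X (𝟙_ B) Y ≫ ((ρ_ (𝟙_ B)).hom ⊗ₘ k) ≫ (λ_ Z).hom := by
      rw [leftUnitor_monoidal]
      simp [MonoidalCategory.unitors_equal, MonoidalCategory.tensorHom_def]
    exact heq_of_eq (key _)
  | @label b n p g hg ih =>
    exact slide_step_append b (congrArg realize (comp_append hf hg f' g')) (ih hf)
  | output _ ih => exact ih hf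
  | @input n p g hg ih =>
    induction f generalizing m with
    | nil => cases hf
    | cons a f ihf =>
      cases hf with
      | @label b m n _ h =>
        exact associator_step_append b (congrArg realize (comp_append h hg.input f' g')) (ihf h)
      | input h => exact ihf h
      | output h => exact ih h

end Letter

/-! ### Coherence when some factors carry no labels -/

namespace Letter

open MonoidalCategory

section Abstract

variable {B : Type u} [Category.{v} B] [MonoidalCategory B] {X Y Z P Q R S S' T U V W : B}

/-- Here and in the next two lemmas one of the three factors in the associativity law is the unit;
after cancelling unitors, two comparisons are seen to coincide. -/
theorem heq_of_assoc_right_unit {m : X ⊗ Y ⟶ P} {k : P ⊗ U ⟶ S} {n : Y ⊗ U ⟶ Q}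
    {l : X ⊗ Q ⟶ S'} (hU : U = 𝟙_ B) (hQ : Q = Y) (hS : S = P) (hS' : S' = P)
    (hk : k ≍ (ρ_ P).hom) (hn : n ≍ (ρ_ Y).hom)
    (h : m ▷ U ≫ k ≍ (α_ X Y U).hom ≫ X ◁ n ≫ l) : l ≍ m := by
  subst hU hQ hS hS' hk hn
  have := eq_of_heq h
  rw [MonoidalCategory.rightUnitor_naturality, MonoidalCategory.rightUnitor_tensor_hom,
    Category.assoc, Iso.cancel_iso_hom_left, cancel_epi] at this
  exact heq_of_eq this.symm

theorem heq_of_assoc_left_unit {m : U ⊗ X ⟶ P} {k : P ⊗ Y ⟶ S} {n : X ⊗ Y ⟶ Q}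
    {l : U ⊗ Q ⟶ S'} (hU : U = 𝟙_ B) (hP : P = X) (hS : S = Q) (hS' : S' = Q)
    (hm : m ≍ (λ_ X).hom) (hl : l ≍ (λ_ Q).hom)
    (h : m ▷ Y ≫ k ≍ (α_ U X Y).hom ≫ U ◁ n ≫ l) : k ≍ n := by
  subst hU hP hS hS' hm hl
  have := eq_of_heq h
  rw [MonoidalCategory.leftUnitor_naturality, MonoidalCategory.leftUnitor_whiskerRight,
    Category.assoc, Iso.cancel_iso_hom_left, Iso.cancel_iso_hom_left] at this
  exact heq_of_eq this

theorem heq_of_assoc_middle_unit {m : X ⊗ U ⟶ P} {k : P ⊗ Y ⟶ S} {n : U ⊗ Y ⟶ Q}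
    {l : X ⊗ Q ⟶ S'} (hU : U = 𝟙_ B) (hP : P = X) (hQ : Q = Y) (hS : S = S')
    (hm : m ≍ (ρ_ X).hom) (hn : n ≍ (λ_ Y).hom)
    (h : m ▷ Y ≫ k ≍ (α_ X U Y).hom ≫ X ◁ n ≫ l) : k ≍ l := by
  subst hU hP hQ hS hm hn
  have := eq_of_heq h
  rw [MonoidalCategory.triangle_assoc, cancel_epi] at this
  exact heq_of_eq this

variable [BraidedCategory B]

theorem heq_of_append_right_unit {m : X ⊗ U ⟶ P} {n : Y ⊗ V ⟶ Q} {k : P ⊗ Q ⟶ S}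
    {r : X ⊗ Y ⟶ R} {s : U ⊗ V ⟶ W} {l : R ⊗ W ⟶ S'}
    (hU : U = 𝟙_ B) (hV : V = 𝟙_ B) (hW : W = 𝟙_ B) (hP : P = X) (hQ : Q = Y) (hS : S = R)
    (hS' : S' = R) (hm : m ≍ (ρ_ X).hom) (hn : n ≍ (ρ_ Y).hom) (hs : s ≍ (λ_ (𝟙_ B)).hom)
    (hl : l ≍ (ρ_ R).hom)
    (h : (m ⊗ₘ n) ≫ k ≍ tensorμ X U Y V ≫ (r ⊗ₘ s) ≫ l) : k ≍ r := by
  subst hU hV hW hP hQ hS hS' hm hn hs hl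
  have := eq_of_heq h
  have hr : tensorμ P (𝟙_ B) Q (𝟙_ B) ≫ (r ⊗ₘ (λ_ (𝟙_ B)).hom) ≫ (ρ_ S').hom =
      ((ρ_ P).hom ⊗ₘ (ρ_ Q).hom) ≫ r := by
    rw [rightUnitor_monoidal, MonoidalCategory.tensorHom_def']
    simp
  rw [hr, cancel_epi] at this
  exact heq_of_eq this

theorem heq_of_append_left_unit {m : U ⊗ X ⟶ P} {n : V ⊗ Y ⟶ Q} {k : P ⊗ Q ⟶ S}
    {r : X ⊗ Y ⟶ R} {s : U ⊗ V ⟶ W} {l : W ⊗ R ⟶ S'}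
    (hU : U = 𝟙_ B) (hV : V = 𝟙_ B) (hW : W = 𝟙_ B) (hP : P = X) (hQ : Q = Y) (hS : S = R)
    (hS' : S' = R) (hm : m ≍ (λ_ X).hom) (hn : n ≍ (λ_ Y).hom) (hs : s ≍ (λ_ (𝟙_ B)).hom)
    (hl : l ≍ (λ_ R).hom)
    (h : (m ⊗ₘ n) ≫ k ≍ tensorμ U X V Y ≫ (s ⊗ₘ r) ≫ l) : k ≍ r := by
  subst hU hV hW hP hQ hS hS' hm hn hs hl
  have := eq_of_heq h
  have hr : tensorμ (𝟙_ B) P (𝟙_ B) Q ≫ ((λ_ (𝟙_ B)).hom ⊗ₘ r) ≫ (λ_ S').hom =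
      ((λ_ P).hom ⊗ₘ (λ_ Q).hom) ≫ r := by
    rw [leftUnitor_monoidal, MonoidalCategory.tensorHom_def]
    simp
  rw [hr, cancel_epi] at this
  exact heq_of_eq this

/-- With units in the outer positions, `tensorμ` becomes the braiding of the inner factors. This is
the origin of the braiding on End(I). -/
theorem heq_of_append_outer_unit {m : U ⊗ X ⟶ P} {n : Y ⊗ V ⟶ Q} {k : P ⊗ Q ⟶ S}
    {r : U ⊗ Y ⟶ R} {s : X ⊗ V ⟶ W} {l : R ⊗ W ⟶ S'} {l' : Y ⊗ X ⟶ T}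
    (hU : U = 𝟙_ B) (hV : V = 𝟙_ B) (hP : P = X) (hQ : Q = Y) (hR : R = Y) (hW : W = X)
    (hS : S = T) (hS' : S' = T) (hm : m ≍ (λ_ X).hom) (hn : n ≍ (ρ_ Y).hom) (hr : r ≍ (λ_ Y).hom)
    (hs : s ≍ (ρ_ X).hom) (hl : l ≍ l')
    (h : (m ⊗ₘ n) ≫ k ≍ tensorμ U X Y V ≫ (r ⊗ₘ s) ≫ l) : k ≍ (β_ X Y).hom ≫ l' := by
  subst hU hV hP hQ hR hW hS hS' hm hn hr hs hl
  have := eq_of_heq h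
  have hr : tensorμ (𝟙_ B) W R (𝟙_ B) ≫ ((λ_ R).hom ⊗ₘ (ρ_ W).hom) =
      ((λ_ W).hom ⊗ₘ (ρ_ R).hom) ≫ (β_ W R).hom := by
    rw [tensorμ]
    monoidal
  rw [reassoc_of% hr, cancel_epi] at this
  exact heq_of_eq this

/-- With units in the inner positions, `tensorμ` only braids the unit with itself and is trivial. -/
theorem heq_of_append_inner_unit {m : X ⊗ U ⟶ P} {n : V ⊗ Y ⟶ Q} {k : P ⊗ Q ⟶ S}
    {r : X ⊗ V ⟶ R} {s : U ⊗ Y ⟶ W} {l : R ⊗ W ⟶ S'} {l' : X ⊗ Y ⟶ T}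
    (hU : U = 𝟙_ B) (hV : V = 𝟙_ B) (hP : P = X) (hQ : Q = Y) (hR : R = X) (hW : W = Y)
    (hS : S = T) (hS' : S' = T) (hm : m ≍ (ρ_ X).hom) (hn : n ≍ (λ_ Y).hom) (hr : r ≍ (ρ_ X).hom)
    (hs : s ≍ (λ_ Y).hom) (hl : l ≍ l')
    (h : (m ⊗ₘ n) ≫ k ≍ tensorμ X U V Y ≫ (r ⊗ₘ s) ≫ l) : k ≍ l' := by
  subst hU hV hP hQ hR hW hS hS' hm hn hr hs hl
  have := eq_of_heq h
  have hr : tensorμ R (𝟙_ B) (𝟙_ B) W ≫ ((ρ_ R).hom ⊗ₘ (λ_ W).hom) =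
      (ρ_ R).hom ⊗ₘ (λ_ W).hom := by
    rw [tensorμ, braiding_tensorUnit_left]
    monoidal
  rw [reassoc_of% hr, cancel_epi] at this
  exact heq_of_eq this

end Abstract

variable {B : Type u} [Category.{v} B] [MonoidalCategory B] [BraidedCategory B]

/-- Plain factors at the end, the beginning or the middle of a composite do not change the
comparison. These three lemmas let the unit constraints be dropped or moved across. -/
theorem compIso_comp_plain (f g : List (Letter B)) {p : List (Letter B)} (hp : Plain p) :
    (compIso f (comp g p)).hom ≍ (compIso f g).hom :=
  heq_of_assoc_right_unit hp.realize_eq (realize_comp_plain g hp)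
    (realize_comp_plain (comp f g) hp) (by rw [← comp_assoc, realize_comp_plain _ hp])
    (compIso_plain (comp f g) hp) (compIso_plain g hp) (compIso_assoc f g p)

theorem plain_comp_compIso {p : List (Letter B)} (hp : Plain p) (f g : List (Letter B)) :
    (compIso (comp p f) g).hom ≍ (compIso f g).hom :=
  heq_of_assoc_left_unit hp.realize_eq (realize_plain_comp hp f)
    (by rw [comp_assoc, realize_plain_comp hp]) (realize_plain_comp hp (comp f g))
    (plain_compIso hp f) (plain_compIso hp (comp f g)) (compIso_assoc p f g)

theorem comp_plain_compIso (f : List (Letter B)) {p : List (Letter B)} (hp : Plain p)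
    (g : List (Letter B)) : (compIso (comp f p) g).hom ≍ (compIso f (comp p g)).hom :=
  heq_of_assoc_middle_unit hp.realize_eq (realize_comp_plain f hp)
    (realize_plain_comp hp g) (by rw [comp_assoc])
    (compIso_plain f hp) (plain_compIso hp g) (compIso_assoc f p g)

theorem compIso_append_plain {l m n : ℕ} {f g p q : List (Letter B)} (hf : Typed l m f)
    (hg : Typed m n g) (hp : Plain p) (hq : Plain q) :
    (compIso (f ++ p) (g ++ q)).hom ≍ (compIso f g).hom := by
  refine heq_of_append_right_unit hp.realize_eq hq.realize_eq (hp.comp hq).realize_eq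
    (realize_append_plain f hp) (realize_append_plain g hq)
    (by rw [comp_append hf hg, realize_append_plain _ (hp.comp hq)])
    (realize_append_plain _ (hp.comp hq))
    (appendIso_plain f hp) (appendIso_plain g hq) ?_ (appendIso_plain _ (hp.comp hq))
    (compIso_append hf hg p q)
  refine (plain_compIso hp q).trans ?_
  rw [hq.realize_eq]

theorem compIso_plain_append {l m n : ℕ} {f g p q : List (Letter B)} (hp : Typed l m p)
    (hq : Typed m n q) (hp' : Plain p) (hq' : Plain q) :
    (compIso (p ++ f) (q ++ g)).hom ≍ (compIso f g).hom := by
  refine heq_of_append_left_unit hp'.realize_eq hq'.realize_eq (hp'.comp hq').realize_eq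
    (realize_plain_append hp' f) (realize_plain_append hq' g)
    (by rw [comp_append hp hq, realize_plain_append (hp'.comp hq')])
    (realize_plain_append (hp'.comp hq') _)
    (plain_appendIso hp' f) (plain_appendIso hq' g) ?_ (plain_appendIso (hp'.comp hq') _)
    (compIso_append hp hq f g)
  refine (plain_compIso hp' q).trans ?_
  rw [hq'.realize_eq]

/-- Here `f` comes first but stands on the right, so its labels have to pass those of `g`. -/
theorem compIso_right_left {l m n p : ℕ} {f g : List (Letter B)}
    (hf : Typed l m f) (hg : Typed n p g) :
    (compIso (strands n ++ f) (g ++ strands m)).hom ≍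
      (β_ (realize f) (realize g)).hom ≫ (appendIso g f).hom := by
  have hn : Plain (strands n : List (Letter B)) := plain_strands n
  have hm : Plain (strands m : List (Letter B)) := plain_strands m
  exact heq_of_append_outer_unit hn.realize_eq hm.realize_eq (realize_plain_append hn f)
    (realize_append_plain g hm) (realize_plain_comp hn g) (realize_comp_plain f hm)
    (by rw [comp_append (typed_strands n) hg, strands_comp hg, comp_strands hf])
    (by rw [strands_comp hg, comp_strands hf])
    (plain_appendIso hn f) (appendIso_plain g hm) (plain_compIso hn g) (compIso_plain f hm)
    (appendIso_heq_appendIso (congrArg labels (strands_comp hg))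
      (congrArg labels (comp_strands hf)))
    (compIso_append (typed_strands n) hg f (strands m))

/-- Here `g` comes first and already stands on the left, so nothing has to pass. -/
theorem compIso_left_right {l m n p : ℕ} {f g : List (Letter B)}
    (hf : Typed l m f) (hg : Typed n p g) :
    (compIso (g ++ strands l) (strands p ++ f)).hom ≍ (appendIso g f).hom := by
  have hl : Plain (strands l : List (Letter B)) := plain_strands l
  have hp : Plain (strands p : List (Letter B)) := plain_strands p
  exact heq_of_append_inner_unit hl.realize_eq hp.realize_eq (realize_append_plain g hl)
    (realize_plain_append hp f) (realize_comp_plain g hp) (realize_plain_comp hl f)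
    (by rw [comp_append hg (typed_strands p), strands_comp hf, comp_strands hg])
    (by rw [strands_comp hf, comp_strands hg])
    (appendIso_plain g hl) (plain_appendIso hp f) (compIso_plain g hp) (plain_compIso hl f)
    (appendIso_heq_appendIso (congrArg labels (comp_strands hg))
      (congrArg labels (strands_comp hf)))
    (compIso_append hg (typed_strands p) (strands l) f)

end Letter

/-! ### Conjugating whiskerings by comparison isomorphisms -/

section Transport

open MonoidalCategory

variable {B : Type u} [Category.{v} B] [MonoidalCategory B]
  {X X' Y Y' Z Z' P P' Q Q' S S' T T' : B}

/-- The coherence hypotheses express `l` and `l'` through the other isomorphisms. After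
substitution, only naturality and interchange in `B` remain; the next two lemmas work in the same
way. -/
theorem tensor_whiskerLeft_transport (m : X ⊗ Y ≅ P) (k : P ⊗ Z ≅ S) (k' : P ⊗ Z' ≅ T)
    (n : Y ⊗ Z ≅ Q) (n' : Y ⊗ Z' ≅ Q') (l : X ⊗ Q ≅ S') (l' : X ⊗ Q' ≅ T')
    (hS : S = S') (hT : T = T')
    (h : m.hom ▷ Z ≫ k.hom ≍ (α_ X Y Z).hom ≫ X ◁ n.hom ≫ l.hom)
    (h' : m.hom ▷ Z' ≫ k'.hom ≍ (α_ X Y Z').hom ≫ X ◁ n'.hom ≫ l'.hom) (η : Z ⟶ Z') :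
    k.inv ≫ P ◁ η ≫ k'.hom =
      eqToHom hS ≫ (l.inv ≫ X ◁ (n.inv ≫ Y ◁ η ≫ n'.hom) ≫ l'.hom) ≫ eqToHom hT.symm := by
  subst hS hT
  obtain rfl : l = (whiskerLeftIso X n).symm ≪≫ (α_ X Y Z).symm ≪≫ whiskerRightIso m Z ≪≫ k := by
    ext; simp [eq_of_heq h]
  obtain rfl :
      l' = (whiskerLeftIso X n').symm ≪≫ (α_ X Y Z').symm ≪≫ whiskerRightIso m Z' ≪≫ k' := by
    ext; simp [eq_of_heq h']
  simp only [Iso.trans_inv, Iso.symm_inv, MonoidalCategory.whiskerRightIso_inv,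
    MonoidalCategory.whiskerLeftIso_hom, Iso.trans_hom, Iso.symm_hom, Category.assoc,
    MonoidalCategory.whiskerRightIso_hom, MonoidalCategory.whiskerLeftIso_inv, eqToHom_refl,
    Category.comp_id, Category.id_comp, MonoidalCategory.whiskerLeft_comp,
    MonoidalCategory.whiskerLeft_hom_inv_assoc]
  rw [← MonoidalCategory.associator_naturality_right_assoc, Iso.hom_inv_id_assoc,
    MonoidalCategory.whisker_exchange_assoc, MonoidalCategory.inv_hom_whiskerRight_assoc]

theorem whisker_assoc_transport (m : X ⊗ Y ≅ P) (m' : X ⊗ Y' ≅ P') (k : P ⊗ Z ≅ S)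
    (k' : P' ⊗ Z ≅ T)
    (n : Y ⊗ Z ≅ Q) (n' : Y' ⊗ Z ≅ Q') (l : X ⊗ Q ≅ S') (l' : X ⊗ Q' ≅ T')
    (hS : S = S') (hT : T = T')
    (h : m.hom ▷ Z ≫ k.hom ≍ (α_ X Y Z).hom ≫ X ◁ n.hom ≫ l.hom)
    (h' : m'.hom ▷ Z ≫ k'.hom ≍ (α_ X Y' Z).hom ≫ X ◁ n'.hom ≫ l'.hom) (η : Y ⟶ Y') :
    k.inv ≫ (m.inv ≫ X ◁ η ≫ m'.hom) ▷ Z ≫ k'.hom =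
      eqToHom hS ≫ (l.inv ≫ X ◁ (n.inv ≫ η ▷ Z ≫ n'.hom) ≫ l'.hom) ≫ eqToHom hT.symm := by
  subst hS hT
  obtain rfl : l = (whiskerLeftIso X n).symm ≪≫ (α_ X Y Z).symm ≪≫ whiskerRightIso m Z ≪≫ k := by
    ext; simp [eq_of_heq h]
  obtain rfl :
      l' = (whiskerLeftIso X n').symm ≪≫ (α_ X Y' Z).symm ≪≫ whiskerRightIso m' Z ≪≫ k' := by
    ext; simp [eq_of_heq h']
  simp

theorem whiskerRight_tensor_transport (m : X ⊗ Y ≅ P) (m' : X' ⊗ Y ≅ P') (k : P ⊗ Z ≅ S)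
    (k' : P' ⊗ Z ≅ T) (n : Y ⊗ Z ≅ Q) (l : X ⊗ Q ≅ S') (l' : X' ⊗ Q ≅ T')
    (hS : S = S') (hT : T = T')
    (h : m.hom ▷ Z ≫ k.hom ≍ (α_ X Y Z).hom ≫ X ◁ n.hom ≫ l.hom)
    (h' : m'.hom ▷ Z ≫ k'.hom ≍ (α_ X' Y Z).hom ≫ X' ◁ n.hom ≫ l'.hom) (η : X ⟶ X') :
    l.inv ≫ η ▷ Q ≫ l'.hom =
      eqToHom hS.symm ≫ (k.inv ≫ (m.inv ≫ η ▷ Y ≫ m'.hom) ▷ Z ≫ k'.hom) ≫ eqToHom hT := by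
  subst hS hT
  obtain rfl : l = (whiskerLeftIso X n).symm ≪≫ (α_ X Y Z).symm ≪≫ whiskerRightIso m Z ≪≫ k := by
    ext; simp [eq_of_heq h]
  obtain rfl :
      l' = (whiskerLeftIso X' n).symm ≪≫ (α_ X' Y Z).symm ≪≫ whiskerRightIso m' Z ≪≫ k' := by
    ext; simp [eq_of_heq h']
  simp [MonoidalCategory.whisker_exchange_assoc]

theorem unit_whiskerLeft_transport (k : X ⊗ Y ≅ S) (k' : X ⊗ Y' ≅ S') (hX : X = 𝟙_ B)
    (hS : S = Y) (hS' : S' = Y') (h : k.hom ≍ (λ_ Y).hom) (h' : k'.hom ≍ (λ_ Y').hom)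
    (η : Y ⟶ Y') : k.inv ≫ X ◁ η ≫ k'.hom = eqToHom hS ≫ η ≫ eqToHom hS'.symm := by
  subst hX hS hS'
  obtain rfl := Iso.ext (eq_of_heq h)
  obtain rfl := Iso.ext (eq_of_heq h')
  simp

theorem whiskerRight_unit_transport (k : Y ⊗ X ≅ S) (k' : Y' ⊗ X ≅ S') (hX : X = 𝟙_ B)
    (hS : S = Y) (hS' : S' = Y') (h : k.hom ≍ (ρ_ Y).hom) (h' : k'.hom ≍ (ρ_ Y').hom)
    (η : Y ⟶ Y') : k.inv ≫ η ▷ X ≫ k'.hom = eqToHom hS ≫ η ≫ eqToHom hS'.symm := by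
  subst hX hS hS'
  obtain rfl := Iso.ext (eq_of_heq h)
  obtain rfl := Iso.ext (eq_of_heq h')
  simp

end Transport

/-! ### The strict 2-category of diagrams -/

/-- The objects of the 2-category of diagrams labelled in `B`: nonempty rows of strands. -/
structure Diagram (B : Type u) : Type (max u v) where
  /-- one less than the number of strands -/
  pred : ℕ

namespace Diagram

open Letter

/-- The number of strands. -/
def size {B : Type u} (X : Diagram.{v} B) : ℕ := X.pred + 1

/-- The tensor product of two rows of strands. -/
def tensorObj {B : Type u} (X Y : Diagram.{v} B) : Diagram.{v} B := ⟨X.pred + Y.pred + 1⟩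

theorem size_tensorObj {B : Type u} (X Y : Diagram.{v} B) :
    (tensorObj X Y).size = X.size + Y.size := by
  simp only [tensorObj, size]; omega

theorem tensorObj_assoc {B : Type u} (X Y Z : Diagram.{v} B) :
    tensorObj (tensorObj X Y) Z = tensorObj X (tensorObj Y Z) := by
  simp only [tensorObj, mk.injEq]; omega

/-- The arrows of the 2-category of diagrams. -/
@[ext]
structure Arrow {B : Type u} (X Y : Diagram.{v} B) : Type (max u v) where
  /-- the underlying word -/
  word : List (Letter B)
  typed : Typed X.size Y.size word

variable {B : Type u} [Category.{v} B] [MonoidalCategory B]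

/-- The 2-cells of the 2-category of diagrams. -/
@[ext]
structure Cell {X Y : Diagram.{v} B} (f g : Arrow X Y) : Type v where
  /-- the underlying morphism of `B` -/
  val : realize f.word ⟶ realize g.word

@[simps]
instance arrowCategory (X Y : Diagram.{v} B) : Category (Arrow X Y) where
  Hom := Cell
  id _ := ⟨𝟙 _⟩
  comp η θ := ⟨η.val ≫ θ.val⟩
  id_comp _ := Cell.ext (Category.id_comp _)
  comp_id _ := Cell.ext (Category.comp_id _)
  assoc _ _ _ := Cell.ext (Category.assoc _ _ _)

/-- The invertible 2-cell between arrows with the same labels. -/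
def relabel {X Y : Diagram.{v} B} {f g : Arrow X Y} (h : labels f.word = labels g.word) :
    f ≅ g where
  hom := ⟨eqToHom (realize_congr h)⟩
  inv := ⟨eqToHom (realize_congr h).symm⟩
  hom_inv_id := Cell.ext (by simp)
  inv_hom_id := Cell.ext (by simp)

variable [BraidedCategory B]

/-- Equality of words, unlike mere equality of labels, also identifies the comparisons. Hence
whiskered associators and unitors are again equalities, which settles pentagon and triangle. -/
theorem whiskerLeft_eqToHom_transport (f : List (Letter B)) {g g' : List (Letter B)} (h : g = g') :
    (compIso f g).inv ≫ MonoidalCategory.whiskerLeft (realize f) (eqToHom (congrArg realize h)) ≫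
      (compIso f g').hom = eqToHom (congrArg (fun w => realize (comp f w)) h) := by
  subst h; simp

theorem eqToHom_whiskerRight_transport {f f' : List (Letter B)} (h : f = f')
    (g : List (Letter B)) :
    (compIso f g).inv ≫ MonoidalCategory.whiskerRight (eqToHom (congrArg realize h)) (realize g) ≫
      (compIso f' g).hom = eqToHom (congrArg (fun w => realize (comp w g)) h) := by
  subst h; simp

instance bicategory : Bicategory.{v, max u v} (Diagram.{v} B) where
  Hom X Y := Arrow X Y
  id X := ⟨strands X.size, typed_strands _⟩
  comp f g := ⟨comp f.word g.word, f.typed.comp g.typed⟩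
  homCategory X Y := arrowCategory X Y
  whiskerLeft f g g' η := ⟨(compIso f.word g.word).inv ≫
    MonoidalCategory.whiskerLeft (realize f.word) η.val ≫ (compIso f.word g'.word).hom⟩
  whiskerRight {_ _ _ f f'} η g := ⟨(compIso f.word g.word).inv ≫
    MonoidalCategory.whiskerRight η.val (realize g.word) ≫ (compIso f'.word g.word).hom⟩
  associator f g h := relabel (congrArg labels (comp_assoc f.word g.word h.word))
  leftUnitor f := relabel (congrArg labels (strands_comp f.typed))
  rightUnitor f := relabel (congrArg labels (comp_strands f.typed))
  whiskerLeft_id f g := Cell.ext (by simp)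
  whiskerLeft_comp f _ _ _ η θ := Cell.ext (by simp)
  id_whiskerLeft {X Y f f'} η := Cell.ext <| unit_whiskerLeft_transport _ _
    (plain_strands X.size).realize_eq (congrArg realize (strands_comp f.typed))
    (congrArg realize (strands_comp f'.typed)) (plain_compIso (plain_strands X.size) f.word)
    (plain_compIso (plain_strands X.size) f'.word) η.val
  comp_whiskerLeft f g _ _ η := Cell.ext <| tensor_whiskerLeft_transport _ _ _ _ _ _ _
    (congrArg realize (comp_assoc _ _ _)) (congrArg realize (comp_assoc _ _ _))
    (compIso_assoc _ _ _) (compIso_assoc _ _ _) _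
  id_whiskerRight f g := Cell.ext (by simp)
  comp_whiskerRight η θ g := Cell.ext (by simp)
  whiskerRight_id {X Y f f'} η := Cell.ext <| whiskerRight_unit_transport _ _
    (plain_strands Y.size).realize_eq (congrArg realize (comp_strands f.typed))
    (congrArg realize (comp_strands f'.typed)) (compIso_plain f.word (plain_strands Y.size))
    (compIso_plain f'.word (plain_strands Y.size)) η.val
  whiskerRight_comp η g h := Cell.ext <| whiskerRight_tensor_transport _ _ _ _ _ _ _
    (congrArg realize (comp_assoc _ _ _)) (congrArg realize (comp_assoc _ _ _))
    (compIso_assoc _ _ _) (compIso_assoc _ _ _) _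
  whisker_assoc f _ _ η h := Cell.ext <| whisker_assoc_transport _ _ _ _ _ _ _ _
    (congrArg realize (comp_assoc _ _ _)) (congrArg realize (comp_assoc _ _ _))
    (compIso_assoc _ _ _) (compIso_assoc _ _ _) _
  whisker_exchange η θ := Cell.ext (by simp [MonoidalCategory.whisker_exchange_assoc])
  pentagon f g h i := Cell.ext <| by
    simp only [relabel, arrowCategory_comp_val]
    rw [whiskerLeft_eqToHom_transport f.word (comp_assoc g.word h.word i.word),
      eqToHom_whiskerRight_transport (comp_assoc f.word g.word h.word) i.word]
    simp
  triangle f g := Cell.ext <| by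
    simp only [relabel, arrowCategory_comp_val]
    rw [whiskerLeft_eqToHom_transport f.word (strands_comp g.typed),
      eqToHom_whiskerRight_transport (comp_strands f.typed) g.word]
    simp

end Diagram

/-! ### The strictly associative tensor product -/

section Transport

open MonoidalCategory

variable {B : Type u} [Category.{v} B] [MonoidalCategory B]

/-- The interchange coherence at source and target is joined by naturality of `tensorμ`. Taking one
pair of morphisms to be identities gives compatibility of the tensor product with either whiskering.
-/
theorem tensor_transport [BraidedCategory B]
    {X₁ X₁' X₂ X₂' Y₁ Y₁' Y₂ Y₂' P P' Q Q' R₁ R₁' R₂ R₂' S S' T T' : B}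
    (a : X₁ ⊗ X₂ ≅ P) (a' : X₁' ⊗ X₂' ≅ P') (b : Y₁ ⊗ Y₂ ≅ Q) (b' : Y₁' ⊗ Y₂' ≅ Q')
    (k : P ⊗ Q ≅ S) (k' : P' ⊗ Q' ≅ S') (r : X₁ ⊗ Y₁ ≅ R₁) (r' : X₁' ⊗ Y₁' ≅ R₁')
    (s : X₂ ⊗ Y₂ ≅ R₂) (s' : X₂' ⊗ Y₂' ≅ R₂') (l : R₁ ⊗ R₂ ≅ T) (l' : R₁' ⊗ R₂' ≅ T')
    (hS : T = S) (hS' : T' = S')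
    (h : (a.hom ⊗ₘ b.hom) ≫ k.hom ≍ tensorμ X₁ X₂ Y₁ Y₂ ≫ (r.hom ⊗ₘ s.hom) ≫ l.hom)
    (h' : (a'.hom ⊗ₘ b'.hom) ≫ k'.hom ≍ tensorμ X₁' X₂' Y₁' Y₂' ≫ (r'.hom ⊗ₘ s'.hom) ≫ l'.hom)
    (φ₁ : X₁ ⟶ X₁') (φ₂ : X₂ ⟶ X₂') (η₁ : Y₁ ⟶ Y₁') (η₂ : Y₂ ⟶ Y₂') :
    l.inv ≫ ((r.inv ≫ (φ₁ ⊗ₘ η₁) ≫ r'.hom) ⊗ₘ (s.inv ≫ (φ₂ ⊗ₘ η₂) ≫ s'.hom)) ≫ l'.hom =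
      eqToHom hS ≫ (k.inv ≫ ((a.inv ≫ (φ₁ ⊗ₘ φ₂) ≫ a'.hom) ⊗ₘ (b.inv ≫ (η₁ ⊗ₘ η₂) ≫ b'.hom)) ≫
        k'.hom) ≫ eqToHom hS'.symm := by
  subst hS hS'
  have e : k.inv ≫ (a.inv ⊗ₘ b.inv) ≫ tensorμ X₁ X₂ Y₁ Y₂ = l.inv ≫ (r.inv ⊗ₘ s.inv) := by
    have h₀ := eq_of_heq h
    rw [← cancel_epi k.hom, Iso.hom_inv_id_assoc, ← cancel_epi (a.hom ⊗ₘ b.hom), reassoc_of% h₀]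
    simp
  have h₀' := eq_of_heq h'
  simp only [eqToHom_refl, Category.id_comp, Category.comp_id, Category.assoc,
    ← tensorHom_comp_tensorHom]
  rw [h₀', tensorμ_natural_assoc, reassoc_of% e]

theorem append_transport {X X' Y Y' Z Z' P P' Q Q' S S' T T' : B}
    (m : X ⊗ Y ≅ P) (m' : X' ⊗ Y' ≅ P') (k : P ⊗ Z ≅ S) (k' : P' ⊗ Z' ≅ S')
    (n : Y ⊗ Z ≅ Q) (n' : Y' ⊗ Z' ≅ Q') (l : X ⊗ Q ≅ T) (l' : X' ⊗ Q' ≅ T')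
    (hS : S = T) (hS' : S' = T')
    (h : m.hom ▷ Z ≫ k.hom ≍ (α_ X Y Z).hom ≫ X ◁ n.hom ≫ l.hom)
    (h' : m'.hom ▷ Z' ≫ k'.hom ≍ (α_ X' Y' Z').hom ≫ X' ◁ n'.hom ≫ l'.hom)
    (φ : X ⟶ X') (ψ : Y ⟶ Y') (χ : Z ⟶ Z') :
    k.inv ≫ ((m.inv ≫ (φ ⊗ₘ ψ) ≫ m'.hom) ⊗ₘ χ) ≫ k'.hom ≍
      l.inv ≫ (φ ⊗ₘ (n.inv ≫ (ψ ⊗ₘ χ) ≫ n'.hom)) ≫ l'.hom := by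
  subst hS hS'
  apply heq_of_eq
  obtain rfl : k = (whiskerRightIso m Z).symm ≪≫ α_ X Y Z ≪≫ whiskerLeftIso X n ≪≫ l := by
    ext; simp [← eq_of_heq h]
  obtain rfl :
      k' = (whiskerRightIso m' Z').symm ≪≫ α_ X' Y' Z' ≪≫ whiskerLeftIso X' n' ≪≫ l' := by
    ext; simp [← eq_of_heq h']
  simp only [MonoidalCategory.tensorHom_def, Iso.trans_inv, Iso.trans_hom, Iso.symm_hom,
    Iso.symm_inv, MonoidalCategory.whiskerRightIso_hom, MonoidalCategory.whiskerRightIso_inv,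
    MonoidalCategory.whiskerLeftIso_hom, MonoidalCategory.whiskerLeftIso_inv,
    MonoidalCategory.whiskerLeft_comp, MonoidalCategory.comp_whiskerRight, Category.assoc,
    MonoidalCategory.whisker_exchange_assoc, MonoidalCategory.hom_inv_whiskerRight_assoc]
  rw [← MonoidalCategory.whisker_exchange_assoc φ n.inv]
  simp

theorem conj_tensorHom_comp {X X' X'' Y Y' Y'' Z Z' Z'' : B} (a : X ⊗ Y ≅ Z) (a' : X' ⊗ Y' ≅ Z')
    (a'' : X'' ⊗ Y'' ≅ Z'') (φ : X ⟶ X') (φ' : X' ⟶ X'') (ψ : Y ⟶ Y') (ψ' : Y' ⟶ Y'') :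
    a.inv ≫ (φ ≫ φ' ⊗ₘ ψ ≫ ψ') ≫ a''.hom =
      (a.inv ≫ (φ ⊗ₘ ψ) ≫ a'.hom) ≫ a'.inv ≫ (φ' ⊗ₘ ψ') ≫ a''.hom := by
  simp

end Transport

namespace Diagram

open Letter

variable {B : Type u} [Category.{v} B] [MonoidalCategory B] [BraidedCategory B]

/-- The word underlying an arrow. -/
def word {X Y : Diagram.{v} B} (f : X ⟶ Y) : List (Letter B) := Arrow.word f

theorem word_typed {X Y : Diagram.{v} B} (f : X ⟶ Y) : Typed X.size Y.size (word f) :=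
  Arrow.typed f

theorem hom_ext {X Y : Diagram.{v} B} {f g : X ⟶ Y} (h : word f = word g) : f = g :=
  Arrow.ext h

theorem word_id (X : Diagram.{v} B) : word (𝟙 X) = strands X.size := rfl

theorem word_comp {X Y Z : Diagram.{v} B} (f : X ⟶ Y) (g : Y ⟶ Z) :
    word (f ≫ g) = comp (word f) (word g) := rfl

/-- The morphism of `B` underlying a 2-cell. -/
def val {X Y : Diagram.{v} B} {f g : X ⟶ Y} (η : f ⟶ g) :
    realize (word f) ⟶ realize (word g) := Cell.val η

theorem cell_ext {X Y : Diagram.{v} B} {f g : X ⟶ Y} {η θ : f ⟶ g} (h : val η = val θ) : η = θ :=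
  Cell.ext h

@[simp] theorem val_id {X Y : Diagram.{v} B} (f : X ⟶ Y) : val (𝟙 f) = 𝟙 _ := rfl

@[simp] theorem val_comp {X Y : Diagram.{v} B} {f g h : X ⟶ Y} (η : f ⟶ g) (θ : g ⟶ h) :
    val (η ≫ θ) = val η ≫ val θ := rfl

theorem val_whiskerLeft {X Y Z : Diagram.{v} B} (f : X ⟶ Y) {g g' : Y ⟶ Z} (η : g ⟶ g') :
    val (f ◁ η) = (compIso (word f) (word g)).inv ≫
      MonoidalCategory.whiskerLeft (realize (word f)) (val η) ≫
        (compIso (word f) (word g')).hom := rfl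

theorem val_whiskerRight {X Y Z : Diagram.{v} B} {f f' : X ⟶ Y} (η : f ⟶ f') (g : Y ⟶ Z) :
    val (η ▷ g) = (compIso (word f) (word g)).inv ≫
      MonoidalCategory.whiskerRight (val η) (realize (word g)) ≫
        (compIso (word f') (word g)).hom := rfl

theorem val_eqToHom {X Y : Diagram.{v} B} {f g : X ⟶ Y} (h : f = g) :
    val (eqToHom h) = eqToHom (congrArg (fun k => realize (word k)) h) := by
  subst h; rfl

theorem id_comp_eq {X Y : Diagram.{v} B} (f : X ⟶ Y) : 𝟙 X ≫ f = f :=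
  hom_ext (strands_comp (word_typed f))

theorem comp_id_eq {X Y : Diagram.{v} B} (f : X ⟶ Y) : f ≫ 𝟙 Y = f :=
  hom_ext (comp_strands (word_typed f))

theorem comp_assoc_eq {X Y Z W : Diagram.{v} B} (f : X ⟶ Y) (g : Y ⟶ Z) (h : Z ⟶ W) :
    (f ≫ g) ≫ h = f ≫ g ≫ h :=
  hom_ext (comp_assoc (word f) (word g) (word h))

instance strict : Bicategory.Strict (Diagram.{v} B) where
  id_comp := id_comp_eq
  comp_id := comp_id_eq
  assoc := comp_assoc_eq
  leftUnitor_eqToIso f := Iso.ext (cell_ext (val_eqToHom (id_comp_eq f)).symm)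
  rightUnitor_eqToIso f := Iso.ext (cell_ext (val_eqToHom (comp_id_eq f)).symm)
  associator_eqToIso f g h := Iso.ext (cell_ext (val_eqToHom (comp_assoc_eq f g h)).symm)

/-- Juxtaposition of diagrams. -/
def tensorArrow {X X' Y Y' : Diagram.{v} B} (f : X ⟶ X') (g : Y ⟶ Y') :
    tensorObj X Y ⟶ tensorObj X' Y' :=
  Arrow.mk (word f ++ word g) (by
    rw [size_tensorObj, size_tensorObj]; exact (word_typed f).append (word_typed g))

/-- Juxtaposition of 2-cells. -/
def tensorCell {X X' Y Y' : Diagram.{v} B} {f f' : X ⟶ X'} {g g' : Y ⟶ Y'} (φ : f ⟶ f')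
    (ψ : g ⟶ g') : tensorArrow f g ⟶ tensorArrow f' g' :=
  Cell.mk ((appendIso (word f) (word g)).inv ≫ MonoidalCategory.tensorHom (val φ) (val ψ) ≫
    (appendIso (word f') (word g')).hom)

theorem val_tensorCell {X X' Y Y' : Diagram.{v} B} {f f' : X ⟶ X'} {g g' : Y ⟶ Y'} (φ : f ⟶ f')
    (ψ : g ⟶ g') : val (tensorCell φ ψ) = (appendIso (word f) (word g)).inv ≫
      MonoidalCategory.tensorHom (val φ) (val ψ) ≫ (appendIso (word f') (word g')).hom := rfl

theorem tensorArrow_id (X Y : Diagram.{v} B) : tensorArrow (𝟙 X) (𝟙 Y) = 𝟙 (tensorObj X Y) :=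
  hom_ext (by rw [word_id, size_tensorObj, strands_add]; rfl)

theorem tensorArrow_comp {X X' X'' Y Y' Y'' : Diagram.{v} B} (f : X ⟶ X') (f' : X' ⟶ X'')
    (g : Y ⟶ Y') (g' : Y' ⟶ Y'') :
    tensorArrow (f ≫ f') (g ≫ g') = tensorArrow f g ≫ tensorArrow f' g' :=
  hom_ext (comp_append (word_typed f) (word_typed f') (word g) (word g')).symm

theorem tensorCell_id {X X' Y Y' : Diagram.{v} B} (f : X ⟶ X') (g : Y ⟶ Y') :
    tensorCell (𝟙 f) (𝟙 g) = 𝟙 (tensorArrow f g) :=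
  cell_ext (by
    rw [val_tensorCell, val_id, val_id, MonoidalCategory.id_tensorHom_id, Category.id_comp]
    exact Iso.inv_hom_id _)

theorem tensorCell_comp {X X' Y Y' : Diagram.{v} B} {f f' f'' : X ⟶ X'} {g g' g'' : Y ⟶ Y'}
    (φ : f ⟶ f') (φ' : f' ⟶ f'') (ψ : g ⟶ g') (ψ' : g' ⟶ g'') :
    tensorCell (φ ≫ φ') (ψ ≫ ψ') = tensorCell φ ψ ≫ tensorCell φ' ψ' :=
  cell_ext (conj_tensorHom_comp _ (appendIso _ _) _ _ _ _ _)

theorem tensorCell_whiskerLeft {X X' X'' Y Y' Y'' : Diagram.{v} B} (f : X ⟶ X')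
    {f₁ f₂ : X' ⟶ X''} (φ : f₁ ⟶ f₂) (g : Y ⟶ Y') {g₁ g₂ : Y' ⟶ Y''} (ψ : g₁ ⟶ g₂) :
    tensorCell (f ◁ φ) (g ◁ ψ) = eqToHom (tensorArrow_comp f f₁ g g₁) ≫
      tensorArrow f g ◁ tensorCell φ ψ ≫ eqToHom (tensorArrow_comp f f₂ g g₂).symm := by
  apply cell_ext
  have := tensor_transport (appendIso (word f) (word g)) (appendIso (word f) (word g)) _ _ _ _
    _ _ _ _ _ _ (congrArg (fun k => realize (word k)) (tensorArrow_comp f f₁ g g₁))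
    (congrArg (fun k => realize (word k)) (tensorArrow_comp f f₂ g g₂))
    (compIso_append (word_typed f) (word_typed f₁) (word g) (word g₁))
    (compIso_append (word_typed f) (word_typed f₂) (word g) (word g₂)) (𝟙 _) (𝟙 _) (val φ) (val ψ)
  rw [val_comp, val_comp, val_eqToHom, val_eqToHom]
  simp only [MonoidalCategory.id_tensorHom, Category.id_comp,
    MonoidalCategory.whiskerLeft_id, Iso.inv_hom_id] at this
  exact this

theorem tensorCell_whiskerRight {X X' X'' Y Y' Y'' : Diagram.{v} B} {f₁ f₂ : X ⟶ X'}
    (φ : f₁ ⟶ f₂) (f : X' ⟶ X'') {g₁ g₂ : Y ⟶ Y'} (ψ : g₁ ⟶ g₂) (g : Y' ⟶ Y'') :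
    tensorCell (φ ▷ f) (ψ ▷ g) = eqToHom (tensorArrow_comp f₁ f g₁ g) ≫
      tensorCell φ ψ ▷ tensorArrow f g ≫ eqToHom (tensorArrow_comp f₂ f g₂ g).symm := by
  apply cell_ext
  have := tensor_transport _ _ (appendIso (word f) (word g)) (appendIso (word f) (word g)) _ _
    _ _ _ _ _ _ (congrArg (fun k => realize (word k)) (tensorArrow_comp f₁ f g₁ g))
    (congrArg (fun k => realize (word k)) (tensorArrow_comp f₂ f g₂ g))
    (compIso_append (word_typed f₁) (word_typed f) (word g₁) (word g))
    (compIso_append (word_typed f₂) (word_typed f) (word g₂) (word g)) (val φ) (val ψ) (𝟙 _) (𝟙 _)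
  rw [val_comp, val_comp, val_eqToHom, val_eqToHom]
  simp only [MonoidalCategory.tensorHom_id, MonoidalCategory.id_whiskerRight, Category.id_comp,
    Iso.inv_hom_id] at this
  exact this

/-- Juxtaposition as a strict 2-functor. -/
def tensorFunctor : StrictPseudofunctor (Diagram.{v} B × Diagram.{v} B) (Diagram.{v} B) :=
  StrictPseudofunctor.mk''
    { obj X := tensorObj X.1 X.2
      map f := tensorArrow f.1 f.2
      map₂ η := tensorCell η.1 η.2
      map₂_id f := tensorCell_id f.1 f.2
      map₂_comp η θ := tensorCell_comp η.1 θ.1 η.2 θ.2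
      map_id X := tensorArrow_id X.1 X.2
      map_comp f g := tensorArrow_comp f.1 g.1 f.2 g.2
      map₂_whisker_left f _ _ η := tensorCell_whiskerLeft f.1 η.1 f.2 η.2
      map₂_whisker_right η g := tensorCell_whiskerRight η.1 g.1 η.2 g.2 }

theorem arrow_heq {X X' Y Y' : Diagram.{v} B} (hX : X = X') (hY : Y = Y') {f : X ⟶ Y}
    {f' : X' ⟶ Y'} (h : word f = word f') : f ≍ f' := by
  subst hX hY
  exact heq_of_eq (hom_ext h)

/-- Differently bracketed tensor products have provably equal but distinct boundaries; comparing
words and underlying morphisms avoids transport along these equalities. -/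
theorem cell_heq {X X' Y Y' : Diagram.{v} B} (hX : X = X') (hY : Y = Y') {f g : X ⟶ Y}
    {f' g' : X' ⟶ Y'} (hf : word f = word f') (hg : word g = word g') {η : f ⟶ g} {η' : f' ⟶ g'}
    (h : val η ≍ val η') : η ≍ η' := by
  subst hX hY
  obtain rfl := hom_ext hf
  obtain rfl := hom_ext hg
  exact heq_of_eq (cell_ext (eq_of_heq h))

/-- The strictly associative tensor product of diagrams. -/
def tensor : StrictTensor (Diagram.{v} B) where
  functor := tensorFunctor
  obj_assoc := tensorObj_assoc
  map_assoc f g h := arrow_heq (tensorObj_assoc _ _ _) (tensorObj_assoc _ _ _)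
    (List.append_assoc (word f) (word g) (word h))
  map₂_assoc {_ _ _ _ _ _ f f' g g' h h'} φ ψ χ :=
    cell_heq (f := tensorArrow (tensorArrow f g) h) (g := tensorArrow (tensorArrow f' g') h')
      (f' := tensorArrow f (tensorArrow g h)) (g' := tensorArrow f' (tensorArrow g' h'))
      (tensorObj_assoc _ _ _) (tensorObj_assoc _ _ _) (List.append_assoc _ _ _)
      (List.append_assoc _ _ _)
      (append_transport _ _ _ _ _ _ _ _ (congrArg realize (List.append_assoc _ _ _))
        (congrArg realize (List.append_assoc _ _ _)) (appendIso_assoc _ _ _)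
        (appendIso_assoc _ _ _) (val φ) (val ψ) (val χ))

end Diagram

/-! ### Cells carried by identities -/

section Transport

open MonoidalCategory

variable {B : Type u} [Category.{v} B] [MonoidalCategory B]

theorem conj_tensorHom_eqToHom {X X' Y Y' S S' : B} (k : X ⊗ Y ≅ S) (k' : X' ⊗ Y' ≅ S')
    (hX : X = X') (hY : Y = Y') (hS : S = S') (h : k.hom ≍ k'.hom) :
    k.inv ≫ (eqToHom hX ⊗ₘ eqToHom hY) ≫ k'.hom = eqToHom hS := by
  subst hX hY hS
  obtain rfl := Iso.ext (eq_of_heq h)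
  simp

theorem conj_whiskerLeft_eqToHom {X Y Y' S S' : B} (k : X ⊗ Y ≅ S) (k' : X ⊗ Y' ≅ S')
    (hY : Y = Y') (hS : S = S') (h : k.hom ≍ k'.hom) :
    k.inv ≫ X ◁ eqToHom hY ≫ k'.hom = eqToHom hS := by
  simpa using conj_tensorHom_eqToHom k k' rfl hY hS h

theorem conj_eqToHom_whiskerRight {X X' Y S S' : B} (k : X ⊗ Y ≅ S) (k' : X' ⊗ Y ≅ S')
    (hX : X = X') (hS : S = S') (h : k.hom ≍ k'.hom) :
    k.inv ≫ eqToHom hX ▷ Y ≫ k'.hom = eqToHom hS := by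
  simpa using conj_tensorHom_eqToHom k k' hX rfl hS h

/-- Two successive conjugations of equalities cancel if the intermediate structure maps agree. -/
theorem conj_whisker_comp_eqToHom {X X₁ X₂ Y Y₁ Y₂ S S₁ S₂ S₃ : B}
    (a : X ⊗ Y₁ ≅ S) (b : X ⊗ Y₂ ≅ S₁) (c : X₁ ⊗ Y ≅ S₂) (d : X₂ ⊗ Y ≅ S₃)
    (hY : Y₁ = Y₂) (hX : X₁ = X₂) (hX' : X = X₁) (hY' : Y₂ = Y)
    (hS : S = S₃) (hS₁ : S₁ = S₂) (had : a.hom ≍ d.hom) (hbc : b.hom ≍ c.hom) :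
    (a.inv ≫ X ◁ eqToHom hY ≫ b.hom) ≫ eqToHom hS₁ ≫ (c.inv ≫ eqToHom hX ▷ Y ≫ d.hom) =
      eqToHom hS := by
  subst hY hX hX' hY' hS hS₁
  obtain rfl := Iso.ext (eq_of_heq had)
  obtain rfl := Iso.ext (eq_of_heq hbc)
  simp

end Transport

namespace Diagram

open Letter

variable {B : Type u} [Category.{v} B] [MonoidalCategory B] [BraidedCategory B]

/-- The 2-cell `η` relates arrows with the same labels, and its underlying morphism is the
identity. -/
def IsCast {X Y : Diagram.{v} B} {f g : X ⟶ Y} (η : f ⟶ g) : Prop :=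
  ∃ h : labels (word f) = labels (word g), val η = eqToHom (realize_congr h)

section IsCast

variable {X Y Z : Diagram.{v} B} {f g h : X ⟶ Y}

/-- The principle behind all coherence checks for the weak unit: such a cell is determined by its
boundary. -/
theorem IsCast.eq {η θ : f ⟶ g} (hη : IsCast η) (hθ : IsCast θ) : η = θ := by
  obtain ⟨_, h₁⟩ := hη
  obtain ⟨_, h₂⟩ := hθ
  exact cell_ext (h₁.trans h₂.symm)

theorem isCast_id (f : X ⟶ Y) : IsCast (𝟙 f) := ⟨rfl, rfl⟩

theorem IsCast.comp {η : f ⟶ g} {θ : g ⟶ h} (hη : IsCast η) (hθ : IsCast θ) :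
    IsCast (η ≫ θ) := by
  obtain ⟨e₁, h₁⟩ := hη
  obtain ⟨e₂, h₂⟩ := hθ
  exact ⟨e₁.trans e₂, by rw [val_comp, h₁, h₂, eqToHom_trans]⟩

theorem isCast_eqToHom (e : f = g) : IsCast (eqToHom e) :=
  ⟨by rw [e], val_eqToHom e⟩

/-- The invertible 2-cell between arrows with the same labels. -/
def relabelIso (e : labels (word f) = labels (word g)) : f ≅ g := relabel e

theorem isCast_relabelIso_hom (e : labels (word f) = labels (word g)) :
    IsCast (relabelIso e).hom := ⟨e, rfl⟩

theorem isCast_relabelIso_inv (e : labels (word f) = labels (word g)) :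
    IsCast (relabelIso e).inv := ⟨e.symm, rfl⟩

theorem isCast_associator_hom {W : Diagram.{v} B} (f : X ⟶ Y) (g : Y ⟶ Z) (h : Z ⟶ W) :
    IsCast (α_ f g h).hom := ⟨congrArg labels (comp_assoc _ _ _), rfl⟩

theorem isCast_associator_inv {W : Diagram.{v} B} (f : X ⟶ Y) (g : Y ⟶ Z) (h : Z ⟶ W) :
    IsCast (α_ f g h).inv := ⟨congrArg labels (comp_assoc _ _ _).symm, rfl⟩

theorem isCast_leftUnitor_hom (f : X ⟶ Y) : IsCast (λ_ f).hom :=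
  ⟨congrArg labels (strands_comp (word_typed f)), rfl⟩

theorem isCast_rightUnitor_inv (f : X ⟶ Y) : IsCast (ρ_ f).inv :=
  ⟨congrArg labels (comp_strands (word_typed f)).symm, rfl⟩

theorem isCast_leftUnitor_inv (f : X ⟶ Y) : IsCast (λ_ f).inv :=
  ⟨congrArg labels (strands_comp (word_typed f)).symm, rfl⟩

theorem IsCast.tensorCell {X' Y' : Diagram.{v} B} {f' g' : X' ⟶ Y'} {η : f ⟶ g} {η' : f' ⟶ g'}
    (hη : IsCast η) (hη' : IsCast η') : IsCast (tensorCell η η') := by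
  obtain ⟨e, h⟩ := hη
  obtain ⟨e', h'⟩ := hη'
  have e'' : labels (word (tensorArrow f f')) = labels (word (tensorArrow g g')) :=
    (labels_append _ _).trans ((congrArg₂ _ e e').trans (labels_append _ _).symm)
  refine ⟨e'', ?_⟩
  rw [val_tensorCell, h, h']
  exact conj_tensorHom_eqToHom _ _ _ _ (realize_congr e'') (appendIso_heq_appendIso e e')

/-- Plainness makes both comparisons right unitors. In general whiskering does not preserve casts,
because words with equal labels but different strands may braid `f` differently. -/
theorem IsCast.whiskerLeft_of_plain (f : X ⟶ Y) {p q : Y ⟶ Z} {η : p ⟶ q} (hη : IsCast η)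
    (hp : Plain (word p)) (hq : Plain (word q)) : IsCast (f ◁ η) := by
  obtain ⟨e, h⟩ := hη
  have e' : labels (word (f ≫ p)) = labels (word (f ≫ q)) :=
    (labels_comp_plain _ hp).trans (labels_comp_plain _ hq).symm
  refine ⟨e', ?_⟩
  rw [val_whiskerLeft, h]
  exact conj_whiskerLeft_eqToHom _ _ _ (realize_congr e')
    ((compIso_plain _ hp).trans (compIso_plain _ hq).symm)

theorem IsCast.whiskerRight_of_plain {p q : X ⟶ Y} {η : p ⟶ q} (hη : IsCast η)
    (hp : Plain (word p)) (hq : Plain (word q)) (f : Y ⟶ Z) : IsCast (η ▷ f) := by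
  obtain ⟨e, h⟩ := hη
  have e' : labels (word (p ≫ f)) = labels (word (q ≫ f)) :=
    (labels_plain_comp hp _).trans (labels_plain_comp hq _).symm
  refine ⟨e', ?_⟩
  rw [val_whiskerRight, h]
  exact conj_eqToHom_whiskerRight _ _ _ (realize_congr e')
    ((plain_compIso hp _).trans (plain_compIso hq _).symm)

/-- Whiskering or tensoring with a plain word changes the underlying morphism only by equalities of
objects; likewise in the next three lemmas. -/
theorem val_plain_whiskerLeft {p : X ⟶ Y} (hp : Plain (word p)) {f g : Y ⟶ Z} (η : f ⟶ g) :
    val (p ◁ η) = eqToHom (realize_plain_comp hp (word f)) ≫ val η ≫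
      eqToHom (realize_plain_comp hp (word g)).symm :=
  unit_whiskerLeft_transport _ _ hp.realize_eq (realize_plain_comp hp (word f))
    (realize_plain_comp hp (word g)) (plain_compIso hp _) (plain_compIso hp _) _

theorem val_whiskerRight_plain {p : Y ⟶ Z} (hp : Plain (word p)) {f g : X ⟶ Y} (η : f ⟶ g) :
    val (η ▷ p) = eqToHom (realize_comp_plain (word f) hp) ≫ val η ≫
      eqToHom (realize_comp_plain (word g) hp).symm :=
  whiskerRight_unit_transport _ _ hp.realize_eq (realize_comp_plain (word f) hp)
    (realize_comp_plain (word g) hp) (compIso_plain _ hp) (compIso_plain _ hp) _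

theorem val_plain_tensorCell {X' Y' : Diagram.{v} B} {p : X' ⟶ Y'} (hp : Plain (word p))
    {f g : X ⟶ Y} (η : f ⟶ g) :
    val (tensorCell (𝟙 p) η) = eqToHom (realize_plain_append hp (word f)) ≫ val η ≫
      eqToHom (realize_plain_append hp (word g)).symm := by
  rw [val_tensorCell, val_id, MonoidalCategory.id_tensorHom]
  exact unit_whiskerLeft_transport _ _ hp.realize_eq (realize_plain_append hp _)
    (realize_plain_append hp _) (plain_appendIso hp _) (plain_appendIso hp _) _

theorem val_tensorCell_plain {X' Y' : Diagram.{v} B} {p : X' ⟶ Y'} (hp : Plain (word p))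
    {f g : X ⟶ Y} (η : f ⟶ g) :
    val (tensorCell η (𝟙 p)) = eqToHom (realize_append_plain (word f) hp) ≫ val η ≫
      eqToHom (realize_append_plain (word g) hp).symm := by
  rw [val_tensorCell, val_id, MonoidalCategory.tensorHom_id]
  exact whiskerRight_unit_transport _ _ hp.realize_eq (realize_append_plain _ hp)
    (realize_append_plain _ hp) (appendIso_plain _ hp) (appendIso_plain _ hp) _

theorem IsCast.plain_whiskerLeft {p : X ⟶ Y} (hp : Plain (word p)) {f g : Y ⟶ Z} {η : f ⟶ g}
    (hη : IsCast η) : IsCast (p ◁ η) := by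
  obtain ⟨e, h⟩ := hη
  refine ⟨(labels_plain_comp hp _).trans (e.trans (labels_plain_comp hp _).symm), ?_⟩
  rw [val_plain_whiskerLeft hp, h, eqToHom_trans, eqToHom_trans]
  rfl

theorem IsCast.whiskerRight_plain {p : Y ⟶ Z} (hp : Plain (word p)) {f g : X ⟶ Y} {η : f ⟶ g}
    (hη : IsCast η) : IsCast (η ▷ p) := by
  obtain ⟨e, h⟩ := hη
  refine ⟨(labels_comp_plain _ hp).trans (e.trans (labels_comp_plain _ hp).symm), ?_⟩
  rw [val_whiskerRight_plain hp, h, eqToHom_trans, eqToHom_trans]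
  rfl

end IsCast

theorem twoCell_comp_of_isCast {X₁ X₂ X₃ Y₁ Y₂ Y₃ : Diagram.{v} B} {f₁ g₁ : X₁ ⟶ Y₁}
    {f₂ g₂ : X₂ ⟶ Y₂} {f₃ g₃ : X₃ ⟶ Y₃} {φ : f₁ ⟶ g₁} {ψ : f₂ ⟶ g₂} {χ : f₃ ⟶ g₃}
    (hφ : IsCast φ) (hψ : IsCast ψ) (hχ : IsCast χ) (hX : X₁ = X₂) (hX' : X₁ = X₃)
    (hY : Y₁ = Y₂) (hY' : Y₁ = Y₃) (h : word g₁ = word f₂) (hf : word f₁ = word f₃)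
    (hg : word g₂ = word g₃) : TwoCell.Comp ⟨φ⟩ ⟨ψ⟩ ⟨χ⟩ := by
  subst hX hX' hY hY'
  obtain rfl := hom_ext h
  obtain rfl := hom_ext hf
  obtain rfl := hom_ext hg
  obtain rfl := hχ.eq (hφ.comp hψ)
  exact .mk φ ψ

/-- The four cells may live over differently bracketed objects, so the boundaries are matched as
words. -/
theorem twoCell_square_of_isCast {X₁ X₂ X₃ X₄ Y₁ Y₂ Y₃ Y₄ : Diagram.{v} B} {f₁ g₁ : X₁ ⟶ Y₁}
    {f₂ g₂ : X₂ ⟶ Y₂} {f₃ g₃ : X₃ ⟶ Y₃} {f₄ g₄ : X₄ ⟶ Y₄} {φ : f₁ ⟶ g₁} {ψ : f₂ ⟶ g₂}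
    {φ' : f₃ ⟶ g₃} {ψ' : f₄ ⟶ g₄} (hφ : IsCast φ) (hψ : IsCast ψ) (hφ' : IsCast φ')
    (hψ' : IsCast ψ') (hX : X₁ = X₂) (hX' : X₁ = X₃) (hX'' : X₁ = X₄)
    (hY : Y₁ = Y₂) (hY' : Y₁ = Y₃) (hY'' : Y₁ = Y₄) (h : word g₁ = word f₂)
    (h' : word g₃ = word f₄) (hf : word f₁ = word f₃) (hg : word g₂ = word g₄) :
    TwoCell.Square ⟨φ⟩ ⟨ψ⟩ ⟨φ'⟩ ⟨ψ'⟩ := by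
  subst hX hX' hX'' hY hY' hY''
  obtain rfl := hom_ext h
  obtain rfl := hom_ext h'
  obtain rfl := hom_ext hf
  obtain rfl := hom_ext hg
  exact ⟨_, .mk φ ψ, (hφ.comp hψ).eq (hφ'.comp hψ') ▸ .mk φ' ψ'⟩

/-- Any two parallel plain arrows are isomorphic, so any plain arrow back is a pseudo-inverse. -/
theorem isEquimorphism_of_plain {X Y : Diagram.{v} B} (f : X ⟶ Y) (g : Y ⟶ X)
    (hf : Plain (word f)) (hg : Plain (word g)) : IsEquimorphism f :=
  ⟨g, ⟨relabelIso ((plain_strands _).labels_eq.trans (hf.comp hg).labels_eq.symm)⟩,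
    ⟨relabelIso ((hg.comp hf).labels_eq.trans (plain_strands _).labels_eq.symm)⟩⟩

theorem word_eqToHom {X Y : Diagram.{v} B} (h : X = Y) : word (eqToHom h) = strands X.size := by
  subst h; rfl

theorem word_eqToHom_comp {X Y Z : Diagram.{v} B} (h : X = Y) (f : Y ⟶ Z) :
    word (eqToHom h ≫ f) = word f := by
  subst h
  exact strands_comp (word_typed f)

/-! ### The unit constraints -/

/-- The unit object: one strand. -/
def unit : Diagram.{v} B := ⟨0⟩

/-- The left constraint merges the additional strand with the first strand. -/
def leftUnit (X : Diagram.{v} B) : tensorObj unit X ⟶ X :=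
  Arrow.mk (Letter.input :: strands X.size) (by
    rw [size_tensorObj, Nat.add_comm]; exact (typed_strands X.size).input)

/-- The right constraint merges the additional strand with the last strand. -/
def rightUnit (X : Diagram.{v} B) : tensorObj X unit ⟶ X :=
  -- The last strand of `X` is set apart to be merged with the extra one; it exists because rows are
  -- nonempty.
  Arrow.mk (strands X.pred ++ [Letter.input, Letter.input, Letter.output])
    ((typed_strands X.pred).append (n' := 1) (m' := 2) (.input (.input (.output .nil))))

theorem plain_leftUnit (X : Diagram.{v} B) : Plain (word (leftUnit X)) :=
  (plain_strands X.size).input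

theorem plain_rightUnit (X : Diagram.{v} B) : Plain (word (rightUnit X)) :=
  (plain_strands X.pred).append (.input (.input (.output .nil)))

theorem plain_id (X : Diagram.{v} B) : Plain (word (𝟙 X)) := plain_strands X.size

end Diagram

theorem eqToHom_conj_comp {B : Type u} [Category.{v} B] {A A₁ A₂ X Y C₁ C₂ D : B} (e₁ : A = A₁)
    (e₂ : A₁ = X) (η : X ⟶ Y) (e₃ : Y = C₁) (e₄ : C₁ = C₂) (e₅ : C₂ = D) (e₆ : A = A₂)
    (e₇ : A₂ = X) (e₈ : Y = D) :
    (eqToHom e₁ ≫ (eqToHom e₂ ≫ η ≫ eqToHom e₃) ≫ eqToHom e₄) ≫ eqToHom e₅ =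
      eqToHom e₆ ≫ eqToHom e₇ ≫ η ≫ eqToHom e₈ := by
  subst e₁ e₂ e₃ e₄ e₅ e₆
  simp

namespace Diagram

open Letter

variable {B : Type u} [Category.{v} B] [MonoidalCategory B] [BraidedCategory B]

theorem word_tensorArrow {X X' Y Y' : Diagram.{v} B} (f : X ⟶ X') (g : Y ⟶ Y') :
    word (tensorArrow f g) = word f ++ word g := rfl

/-- Neither whiskering need be a cast when `u` and `g` carry labels. Their composite is one, since
the plain `p` can be moved between the two factors and the outer comparisons agree by `h`. This is
the composition axiom for the naturality of λ and ρ. -/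
theorem isCast_whisker_comp {X X' Y Y' Z Z' : Diagram.{v} B} {u : X ⟶ Y} {g' : Y ⟶ Z'}
    {p' : Z' ⟶ Z} {p : Y ⟶ Y'} {g : Y' ⟶ Z} {q : X ⟶ X'} {f : X' ⟶ Y'}
    {η : g' ≫ p' ⟶ p ≫ g} {θ : u ≫ p ⟶ q ≫ f} (hη : IsCast η) (hθ : IsCast θ)
    (hp : Plain (word p)) (hp' : Plain (word p')) (hq : Plain (word q))
    (hl : labels (word (u ≫ g')) = labels (word (f ≫ g)))
    (h : (compIso (word u) (word g')).hom ≍ (compIso (word f) (word g)).hom) :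
    IsCast (u ◁ η ≫ (α_ u p g).inv ≫ θ ▷ g) := by
  obtain ⟨e₁, h₁⟩ := hη
  obtain ⟨e₂, h₂⟩ := hθ
  have e : labels (word (u ≫ g' ≫ p')) = labels (word ((q ≫ f) ≫ g)) := by
    rw [← comp_assoc_eq u, comp_assoc_eq q]
    exact (labels_comp_plain _ hp').trans (hl.trans (labels_plain_comp hq _).symm)
  refine ⟨e, ?_⟩
  rw [val_comp, val_comp, val_whiskerLeft, val_whiskerRight, h₁, h₂]
  exact conj_whisker_comp_eqToHom _ _ _ _ _ _ (realize_comp_plain _ hp).symm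
    (realize_plain_comp hp _) (realize_congr e) (congrArg realize (comp_assoc _ _ _).symm)
    ((compIso_comp_plain _ _ hp').trans (h.trans (plain_comp_compIso hq _ _).symm))
    (comp_plain_compIso _ hp _).symm

/-- The naturality of the left constraint. -/
def leftNaturality {X Y : Diagram.{v} B} (f : X ⟶ Y) :
    tensorArrow (𝟙 unit) f ≫ leftUnit Y ≅ leftUnit X ≫ f :=
  relabelIso ((labels_comp_plain _ (plain_leftUnit Y)).trans
    ((labels_plain_append (plain_id unit) _).trans (labels_plain_comp (plain_leftUnit X) _).symm))

/-- The naturality of the right constraint. -/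
def rightNaturality {X Y : Diagram.{v} B} (f : X ⟶ Y) :
    tensorArrow f (𝟙 unit) ≫ rightUnit Y ≅ rightUnit X ≫ f :=
  relabelIso ((labels_comp_plain _ (plain_rightUnit Y)).trans
    ((labels_append_plain _ (plain_id unit)).trans (labels_plain_comp (plain_rightUnit X) _).symm))

theorem isCast_leftNaturality {X Y : Diagram.{v} B} (f : X ⟶ Y) :
    IsCast (leftNaturality f).hom := isCast_relabelIso_hom _

theorem isCast_rightNaturality {X Y : Diagram.{v} B} (f : X ⟶ Y) :
    IsCast (rightNaturality f).hom := isCast_relabelIso_hom _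

theorem isCast_tensorLeft_mapComp {X Y Z : Diagram.{v} B} (f : X ⟶ Y) (g : Y ⟶ Z) :
    IsCast (((tensor (B := B)).tensorLeft unit).mapComp f g).hom :=
  ((isCast_rightUnitor_inv (𝟙 unit)).tensorCell (isCast_id (f ≫ g))).comp
    (isCast_eqToHom (tensorArrow_comp (𝟙 unit) (𝟙 unit) f g))

theorem isCast_tensorRight_mapComp {X Y Z : Diagram.{v} B} (f : X ⟶ Y) (g : Y ⟶ Z) :
    IsCast (((tensor (B := B)).tensorRight unit).mapComp f g).hom :=
  ((isCast_id (f ≫ g)).tensorCell (isCast_leftUnitor_inv (𝟙 unit))).comp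
    (isCast_eqToHom (tensorArrow_comp f g (𝟙 unit) (𝟙 unit)))

theorem isCast_tensorLeft_mapId (X : Diagram.{v} B) :
    IsCast (((tensor (B := B)).tensorLeft unit).mapId X).hom :=
  ((isCast_id (𝟙 unit)).tensorCell (isCast_id (𝟙 X))).comp
    (isCast_eqToHom (tensorArrow_id unit X))

theorem isCast_tensorRight_mapId (X : Diagram.{v} B) :
    IsCast (((tensor (B := B)).tensorRight unit).mapId X).hom :=
  ((isCast_id (𝟙 X)).tensorCell (isCast_id (𝟙 unit))).comp
    (isCast_eqToHom (tensorArrow_id X unit))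

/-- The left constraint as a pseudo-natural transformation. -/
def left : Pseudofunctor.StrongTrans ((tensor (B := B)).tensorLeft unit)
    (Pseudofunctor.id (Diagram.{v} B)) where
  app := leftUnit
  naturality := leftNaturality
  naturality_naturality {X Y f g} η := cell_ext (by
    change val (tensorCell (𝟙 (𝟙 unit)) η ▷ leftUnit Y ≫ (leftNaturality g).hom) =
      val ((leftNaturality f).hom ≫ leftUnit X ◁ η)
    obtain ⟨_, h₁⟩ := isCast_leftNaturality f
    obtain ⟨_, h₂⟩ := isCast_leftNaturality g
    rw [val_comp, val_comp, val_whiskerRight_plain (plain_leftUnit Y),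
      val_plain_whiskerLeft (plain_leftUnit X), val_plain_tensorCell (plain_id unit), h₁, h₂]
    exact eqToHom_conj_comp _ _ _ _ _ _ _ _ _)
  naturality_id X := ((isCast_leftNaturality (𝟙 X)).comp
      ((isCast_id (𝟙 X)).plain_whiskerLeft (plain_leftUnit X))).eq
    (((isCast_tensorLeft_mapId X).whiskerRight_plain (plain_leftUnit X)).comp
      ((isCast_leftUnitor_hom _).comp (isCast_rightUnitor_inv _)))
  naturality_comp {X Y Z} f g := by
    refine ((isCast_leftNaturality (f ≫ g)).comp
      ((isCast_id (f ≫ g)).plain_whiskerLeft (plain_leftUnit X))).eq ?_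
    have key : IsCast (tensorArrow (𝟙 unit) f ◁ (leftNaturality g).hom ≫ (α_ _ _ _).inv ≫
        (leftNaturality f).hom ▷ g) := by
      -- The two labelled arrows on the source side are `I ⊗ f` and `I ⊗ g`; an unlabelled strand on
      -- the left does not affect their comparison.
      refine isCast_whisker_comp (isCast_leftNaturality g) (isCast_leftNaturality f)
        (plain_leftUnit Y) (plain_leftUnit Z) (plain_leftUnit X) ?_
        (compIso_plain_append (typed_strands _) (typed_strands _) (plain_id unit) (plain_id unit))
      rw [← tensorArrow_comp]
      exact labels_plain_append ((plain_id unit).comp (plain_id unit)) _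
    have := ((isCast_tensorLeft_mapComp f g).whiskerRight_plain (plain_leftUnit Z)).comp
      ((isCast_associator_hom _ _ _).comp (key.comp (isCast_associator_hom _ _ _)))
    simp only [Category.assoc] at this
    exact this

/-- The right constraint as a pseudo-natural transformation. -/
def right : Pseudofunctor.StrongTrans ((tensor (B := B)).tensorRight unit)
    (Pseudofunctor.id (Diagram.{v} B)) where
  app := rightUnit
  naturality := rightNaturality
  naturality_naturality {X Y f g} η := cell_ext (by
    change val (tensorCell η (𝟙 (𝟙 unit)) ▷ rightUnit Y ≫ (rightNaturality g).hom) =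
      val ((rightNaturality f).hom ≫ rightUnit X ◁ η)
    obtain ⟨_, h₁⟩ := isCast_rightNaturality f
    obtain ⟨_, h₂⟩ := isCast_rightNaturality g
    rw [val_comp, val_comp, val_whiskerRight_plain (plain_rightUnit Y),
      val_plain_whiskerLeft (plain_rightUnit X), val_tensorCell_plain (plain_id unit), h₁, h₂]
    exact eqToHom_conj_comp _ _ _ _ _ _ _ _ _)
  naturality_id X := ((isCast_rightNaturality (𝟙 X)).comp
      ((isCast_id (𝟙 X)).plain_whiskerLeft (plain_rightUnit X))).eq
    (((isCast_tensorRight_mapId X).whiskerRight_plain (plain_rightUnit X)).comp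
      ((isCast_leftUnitor_hom _).comp (isCast_rightUnitor_inv _)))
  naturality_comp {X Y Z} f g := by
    refine ((isCast_rightNaturality (f ≫ g)).comp
      ((isCast_id (f ≫ g)).plain_whiskerLeft (plain_rightUnit X))).eq ?_
    have key : IsCast (tensorArrow f (𝟙 unit) ◁ (rightNaturality g).hom ≫ (α_ _ _ _).inv ≫
        (rightNaturality f).hom ▷ g) := by
      refine isCast_whisker_comp (isCast_rightNaturality g) (isCast_rightNaturality f)
        (plain_rightUnit Y) (plain_rightUnit Z) (plain_rightUnit X) ?_
        (compIso_append_plain (word_typed f) (word_typed g) (plain_id unit) (plain_id unit))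
      rw [← tensorArrow_comp]
      exact labels_append_plain _ ((plain_id unit).comp (plain_id unit))
    have := ((isCast_tensorRight_mapComp f g).whiskerRight_plain (plain_rightUnit Z)).comp
      ((isCast_associator_hom _ _ _).comp (key.comp (isCast_associator_hom _ _ _)))
    simp only [Category.assoc] at this
    exact this

theorem plain_tensorArrow {X X' Y Y' : Diagram.{v} B} {p : X ⟶ X'} {q : Y ⟶ Y'}
    (hp : Plain (word p)) (hq : Plain (word q)) : Plain (word (tensorArrow p q)) :=
  hp.append hq

theorem plain_eqToHom_comp {X Y Z : Diagram.{v} B} (h : X = Y) {p : Y ⟶ Z}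
    (hp : Plain (word p)) : Plain (word (eqToHom h ≫ p)) := by
  rwa [word_eqToHom_comp]

/-- The invertible 2-cell between arrows without labels. -/
def plainIso {X Y : Diagram.{v} B} {p q : X ⟶ Y} (hp : Plain (word p)) (hq : Plain (word q)) :
    p ≅ q :=
  relabelIso (hp.labels_eq.trans hq.labels_eq.symm)

theorem isCast_plainIso {X Y : Diagram.{v} B} {p q : X ⟶ Y} (hp : Plain (word p))
    (hq : Plain (word q)) : IsCast (plainIso hp hq).hom := isCast_relabelIso_hom _

theorem word_id_tensorObj (X Y : Diagram.{v} B) :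
    word (𝟙 (tensorObj X Y)) = word (𝟙 X) ++ word (𝟙 Y) :=
  congrArg word (tensorArrow_id X Y).symm

theorem word_comp_eqToHom_comp {X Y Y' Z : Diagram.{v} B} (f : X ⟶ Y) (h : Y = Y') (g : Y' ⟶ Z) :
    word (f ≫ eqToHom h ≫ g) = comp (word f) (word g) := by
  rw [word_comp, word_eqToHom_comp]

theorem word_eqToHom_comp_comp {X X' Y Z : Diagram.{v} B} (h : X = X') (f : X' ⟶ Y) (g : Y ⟶ Z) :
    word ((eqToHom h ≫ f) ≫ g) = word (f ≫ g) := by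
  rw [comp_assoc_eq, word_eqToHom_comp]

section

variable {X X' X'' Y Y' Y'' : Diagram.{v} B}

theorem tensorArrow_comp_left (f : X ⟶ X') (f' : X' ⟶ X'') (g : Y ⟶ Y') :
    tensorArrow (f ≫ f') g = tensorArrow f (𝟙 Y) ≫ tensorArrow f' g := by
  rw [← tensorArrow_comp, id_comp_eq]

theorem tensorArrow_comp_left' (f : X ⟶ X') (f' : X' ⟶ X'') (g : Y ⟶ Y') :
    tensorArrow (f ≫ f') g = tensorArrow f g ≫ tensorArrow f' (𝟙 Y') := by
  rw [← tensorArrow_comp, comp_id_eq]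

theorem tensorArrow_comp_right (f : X ⟶ X') (g : Y ⟶ Y') (g' : Y' ⟶ Y'') :
    tensorArrow f (g ≫ g') = tensorArrow (𝟙 X) g ≫ tensorArrow f g' := by
  rw [← tensorArrow_comp, id_comp_eq]

theorem tensorArrow_comp_right' (f : X ⟶ X') (g : Y ⟶ Y') (g' : Y' ⟶ Y'') :
    tensorArrow f (g ≫ g') = tensorArrow f g ≫ tensorArrow (𝟙 X') g' := by
  rw [← tensorArrow_comp, comp_id_eq]

theorem word_tensorArrow_comp_eqToHom_comp {Z Z' Z'' : Diagram.{v} B} (f : X ⟶ X') (g : Y ⟶ Y')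
    (h : Z ⟶ Z') (k : tensorObj Y' Z' ⟶ Z'') :
    word (tensorArrow (tensorArrow f g) h ≫ eqToHom (tensorObj_assoc X' Y' Z') ≫
      tensorArrow (𝟙 X') k) = word (tensorArrow f (tensorArrow g h ≫ k)) := by
  rw [word_comp_eqToHom_comp, tensorArrow_comp_right', word_comp]
  simp only [word_tensorArrow, List.append_assoc]

end

/-! ### The modifications and the weak unit -/

/-- The cell `ρ_X ⊗ Y ⇒ X ⊗ λ_Y`. -/
def kelly (X Y : Diagram.{v} B) : tensorArrow (rightUnit X) (𝟙 Y) ≅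
    eqToHom (tensorObj_assoc X unit Y) ≫ tensorArrow (𝟙 X) (leftUnit Y) :=
  plainIso (plain_tensorArrow (plain_rightUnit X) (plain_id Y))
    (plain_eqToHom_comp _ (plain_tensorArrow (plain_id X) (plain_leftUnit Y)))

/-- The cell `λ_{X ⊗ Y} ⇒ λ_X ⊗ Y`. -/
def leftCell (X Y : Diagram.{v} B) :
    eqToHom (tensorObj_assoc unit X Y) ≫ leftUnit (tensorObj X Y) ≅
      tensorArrow (leftUnit X) (𝟙 Y) :=
  plainIso (plain_eqToHom_comp _ (plain_leftUnit (tensorObj X Y)))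
    (plain_tensorArrow (plain_leftUnit X) (plain_id Y))

/-- The cell `ρ_{X ⊗ Y} ⇒ X ⊗ ρ_Y`. -/
def rightCell (X Y : Diagram.{v} B) : rightUnit (tensorObj X Y) ≅
    eqToHom (tensorObj_assoc X Y unit) ≫ tensorArrow (𝟙 X) (rightUnit Y) :=
  plainIso (plain_rightUnit (tensorObj X Y))
    (plain_eqToHom_comp _ (plain_tensorArrow (plain_id X) (plain_rightUnit Y)))

theorem isCast_kelly (X Y : Diagram.{v} B) : IsCast (kelly X Y).hom := isCast_plainIso _ _

theorem isCast_leftCell (X Y : Diagram.{v} B) : IsCast (leftCell X Y).hom := isCast_plainIso _ _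

theorem isCast_rightCell (X Y : Diagram.{v} B) : IsCast (rightCell X Y).hom := isCast_plainIso _ _

theorem isEquimorphism_leftUnit (X : Diagram.{v} B) : IsEquimorphism (leftUnit X) :=
  isEquimorphism_of_plain _
    -- The pseudo-inverse creates a first strand with an empty block.
    (Arrow.mk (Letter.output :: strands X.size) (by
      rw [size_tensorObj, Nat.add_comm]; exact (typed_strands X.size).output))
    (plain_leftUnit X) (plain_strands X.size).output

theorem isEquimorphism_rightUnit (X : Diagram.{v} B) : IsEquimorphism (rightUnit X) :=
  isEquimorphism_of_plain _
    -- The new strand may be put first here too, as any plain arrow back will do.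
    (Arrow.mk (Letter.output :: strands X.size) (by
      rw [size_tensorObj]; exact (typed_strands X.size).output))
    (plain_rightUnit X) (plain_strands X.size).output

/-- One strand is a weak unit. -/
def weakUnit : WeakUnit (tensor (B := B)) where
  unit := unit
  left := left
  left_equi := isEquimorphism_leftUnit
  right := right
  right_equi := isEquimorphism_rightUnit
  kelly := kelly
  leftCell := leftCell
  rightCell := rightCell
  kelly_natural {X X' Y Y'} f g :=
    twoCell_square_of_isCast
      (f₁ := tensorArrow (tensorArrow f (𝟙 unit) ≫ rightUnit X') g)
      (g₁ := tensorArrow (rightUnit X ≫ f) g)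
      (f₄ := tensorArrow f (tensorArrow (𝟙 unit) g ≫ leftUnit Y'))
      (g₄ := tensorArrow f (leftUnit Y ≫ g))
      ((isCast_rightNaturality f).tensorCell (isCast_id g))
      ((isCast_kelly X Y).whiskerRight_of_plain
        (plain_tensorArrow (plain_rightUnit X) (plain_id Y))
        (plain_eqToHom_comp _ (plain_tensorArrow (plain_id X) (plain_leftUnit Y))) _)
      ((isCast_kelly X' Y').whiskerLeft_of_plain _
        (plain_tensorArrow (plain_rightUnit X') (plain_id Y'))
        (plain_eqToHom_comp _ (plain_tensorArrow (plain_id X') (plain_leftUnit Y'))))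
      ((isCast_id f).tensorCell (isCast_leftNaturality g))
      rfl rfl (tensorObj_assoc _ _ _) rfl rfl rfl
      (congrArg word (tensorArrow_comp_left (rightUnit X) f g))
      (word_tensorArrow_comp_eqToHom_comp f (𝟙 unit) g (leftUnit Y'))
      (congrArg word (tensorArrow_comp_left' (tensorArrow f (𝟙 unit)) (rightUnit X') g))
      ((word_eqToHom_comp_comp _ _ _).trans
        (congrArg word (tensorArrow_comp_right f (leftUnit Y) g).symm))
  leftCell_natural {X X' Y Y'} f g :=
    twoCell_square_of_isCast
      (f₁ := tensorArrow (𝟙 unit) (tensorArrow f g) ≫ leftUnit (tensorObj X' Y'))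
      (g₁ := leftUnit (tensorObj X Y) ≫ tensorArrow f g)
      (f₄ := tensorArrow (tensorArrow (𝟙 unit) f ≫ leftUnit X') g)
      (g₄ := tensorArrow (leftUnit X ≫ f) g)
      (isCast_leftNaturality (tensorArrow f g))
      ((isCast_leftCell X Y).whiskerRight_of_plain
        (plain_eqToHom_comp _ (plain_leftUnit (tensorObj X Y)))
        (plain_tensorArrow (plain_leftUnit X) (plain_id Y)) _)
      ((isCast_leftCell X' Y').whiskerLeft_of_plain _
        (plain_eqToHom_comp _ (plain_leftUnit (tensorObj X' Y')))
        (plain_tensorArrow (plain_leftUnit X') (plain_id Y')))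
      ((isCast_leftNaturality f).tensorCell (isCast_id g))
      (tensorObj_assoc _ _ _).symm (tensorObj_assoc _ _ _).symm (tensorObj_assoc _ _ _).symm
      rfl rfl rfl
      (word_eqToHom_comp_comp _ _ _).symm
      (congrArg word (tensorArrow_comp_left' (tensorArrow (𝟙 unit) f) (leftUnit X') g).symm)
      ((congrArg (fun w => comp w _) (List.append_assoc _ _ _).symm).trans
        (word_comp_eqToHom_comp (tensorArrow (tensorArrow (𝟙 unit) f) g)
          (tensorObj_assoc unit X' Y') (leftUnit (tensorObj X' Y'))).symm)
      (congrArg word (tensorArrow_comp_left (leftUnit X) f g).symm)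
  rightCell_natural {X X' Y Y'} f g :=
    twoCell_square_of_isCast
      (f₁ := tensorArrow (tensorArrow f g) (𝟙 unit) ≫ rightUnit (tensorObj X' Y'))
      (g₁ := rightUnit (tensorObj X Y) ≫ tensorArrow f g)
      (f₄ := tensorArrow f (tensorArrow g (𝟙 unit) ≫ rightUnit Y'))
      (g₄ := tensorArrow f (rightUnit Y ≫ g))
      (isCast_rightNaturality (tensorArrow f g))
      ((isCast_rightCell X Y).whiskerRight_of_plain (plain_rightUnit (tensorObj X Y))
        (plain_eqToHom_comp _ (plain_tensorArrow (plain_id X) (plain_rightUnit Y))) _)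
      ((isCast_rightCell X' Y').whiskerLeft_of_plain _ (plain_rightUnit (tensorObj X' Y'))
        (plain_eqToHom_comp _ (plain_tensorArrow (plain_id X') (plain_rightUnit Y'))))
      ((isCast_id f).tensorCell (isCast_rightNaturality g))
      rfl rfl (tensorObj_assoc _ _ _) rfl rfl rfl
      rfl (word_tensorArrow_comp_eqToHom_comp f g (𝟙 unit) (rightUnit Y')) rfl
      ((word_eqToHom_comp_comp _ _ _).trans
        (congrArg word (tensorArrow_comp_right f (rightUnit Y) g).symm))
  left_normalised X Y Z :=
    twoCell_comp_of_isCast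
      (f₁ := tensorArrow (rightUnit X) (𝟙 (tensorObj Y Z)))
      (f₂ := tensorArrow (𝟙 X) (eqToHom (tensorObj_assoc unit Y Z) ≫ leftUnit (tensorObj Y Z)))
      (g₂ := tensorArrow (𝟙 X) (tensorArrow (leftUnit Y) (𝟙 Z)))
      (f₃ := tensorArrow (tensorArrow (rightUnit X) (𝟙 Y)) (𝟙 Z))
      (g₃ := tensorArrow (eqToHom (tensorObj_assoc X unit Y) ≫
        tensorArrow (𝟙 X) (leftUnit Y)) (𝟙 Z))
      (isCast_kelly X (tensorObj Y Z))
      ((isCast_id (𝟙 X)).tensorCell (isCast_leftCell Y Z))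
      ((isCast_kelly X Y).tensorCell (isCast_id (𝟙 Z)))
      ((tensorObj_assoc X unit (tensorObj Y Z)).trans
        (congrArg (tensorObj X) (tensorObj_assoc unit Y Z).symm))
      (tensorObj_assoc (tensorObj X unit) Y Z).symm rfl (tensorObj_assoc X Y Z).symm
      ((word_eqToHom_comp _ _).trans (congrArg (word (𝟙 X) ++ ·) (word_eqToHom_comp _ _).symm))
      ((congrArg (word (rightUnit X) ++ ·) (word_id_tensorObj Y Z)).trans
        (List.append_assoc _ _ _).symm)
      ((List.append_assoc _ _ _).symm.trans
        (congrArg (· ++ word (𝟙 Z)) (word_eqToHom_comp (tensorObj_assoc X unit Y)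
          (tensorArrow (𝟙 X) (leftUnit Y))).symm))
  right_normalised X Y Z :=
    twoCell_comp_of_isCast
      (f₁ := tensorArrow (rightUnit (tensorObj X Y)) (𝟙 Z))
      (g₁ := tensorArrow (eqToHom (tensorObj_assoc X Y unit) ≫
        tensorArrow (𝟙 X) (rightUnit Y)) (𝟙 Z))
      (f₂ := tensorArrow (𝟙 X) (tensorArrow (rightUnit Y) (𝟙 Z)))
      (g₂ := tensorArrow (𝟙 X) (eqToHom (tensorObj_assoc Y unit Z) ≫
        tensorArrow (𝟙 Y) (leftUnit Z)))
      (f₃ := tensorArrow (rightUnit (tensorObj X Y)) (𝟙 Z))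
      ((isCast_rightCell X Y).tensorCell (isCast_id (𝟙 Z)))
      ((isCast_id (𝟙 X)).tensorCell (isCast_kelly Y Z))
      (isCast_kelly (tensorObj X Y) Z)
      ((congrArg (fun W => tensorObj W Z) (tensorObj_assoc X Y unit)).trans
        (tensorObj_assoc X (tensorObj Y unit) Z))
      rfl (tensorObj_assoc X Y Z) rfl
      ((congrArg (· ++ word (𝟙 Z)) (word_eqToHom_comp _ _)).trans (List.append_assoc _ _ _))
      rfl
      ((congrArg (word (𝟙 X) ++ ·) (word_eqToHom_comp _ _)).trans
        ((List.append_assoc _ _ _).symm.trans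
          ((congrArg (· ++ word (leftUnit Z)) (word_id_tensorObj X Y).symm).trans
            (word_eqToHom_comp (tensorObj_assoc (tensorObj X Y) unit Z)
              (tensorArrow (𝟙 (tensorObj X Y)) (leftUnit Z))).symm)))

end Diagram

/-! ### The exchange on the unit computes the braiding -/

/-- The strands are entered and left through the same comparison `n`, which cancels; only `β`
survives. -/
theorem eqToHom_conj_comp_conj {B : Type u} [Category.{v} B] {P P' Q V W R R' S P'' S' T : B}
    (e₁ : P = P') (e₂ : P' = Q) (m : V ≅ Q) (β : V ≅ W) (n : W ≅ R) (e₃ : R = R') (e₄ : R' = S)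
    (e₅ : S = R) (m' : W ≅ T) (e₆ : T = S') (e₇ : S' = P'') (e₈ : P = Q) (e₉ : T = P'') :
    eqToHom e₁ ≫ (eqToHom e₂ ≫ (m.inv ≫ (β ≪≫ n).hom) ≫ eqToHom e₃) ≫ eqToHom e₄ ≫
      (eqToHom e₅ ≫ (n.inv ≫ m'.hom) ≫ eqToHom e₆) ≫ eqToHom e₇ =
    eqToHom e₈ ≫ (m.inv ≫ β.hom ≫ m'.hom) ≫ eqToHom e₉ := by
  subst e₁ e₂ e₃ e₄ e₆ e₇
  simp

theorem comp_eqToHom_of_heq {B : Type u} [Category.{v} B] {X Y S S' : B} {φ : X ⟶ Y}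
    {ψ : Y ⟶ S} {χ : X ⟶ S'} (e : S = S') (h : φ ≫ ψ ≍ χ) : φ ≫ ψ ≫ eqToHom e = χ := by
  subst e
  simpa using h

theorem comp_eqToHom_of_heq' {B : Type u} [Category.{v} B] {X S S' : B} {ψ : X ⟶ S}
    {χ : X ⟶ S'} (e : S = S') (h : ψ ≍ χ) : ψ ≫ eqToHom e = χ := by
  subst e
  simpa using h

open Functor.LaxMonoidal Functor.OplaxMonoidal in
/-- The inverse of a braided monoidal equivalence is braided monoidal. -/
theorem CategoryTheory.Equivalence.nonempty_braided_inverse {C : Type*} {D : Type*} [Category* C]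
    [Category* D] [MonoidalCategory C] [MonoidalCategory D] [BraidedCategory C]
    [BraidedCategory D] (e : C ≌ D) [e.functor.Braided] : Nonempty e.inverse.Braided := by
  let := e.inverseMonoidal
  refine ⟨{ braided := fun X Y => ?_ }⟩
  -- The tensorator of the inverse is the transpose of `δ` followed by counits. By naturality of
  -- transposition on both sides, the claim reduces to compatibility of `δ` with the braidings.
  have hμ (X Y : D) : μ e.inverse X Y = e.toAdjunction.homEquiv _ _
    (δ e.functor _ _ ≫ MonoidalCategory.tensorHom (e.toAdjunction.counit.app X)
      (e.toAdjunction.counit.app Y)) := rfl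
  rw [hμ, hμ, ← Adjunction.homEquiv_naturality_right, ← Adjunction.homEquiv_naturality_left]
  congr 1
  simp

section Transport

open MonoidalCategory

variable {B : Type u} [Category.{v} B] [MonoidalCategory B]

theorem conj_whiskerRight_comp_whiskerLeft {X X₁ X₂ Y Y₁ Y₂ S S₁ S₂ S₃ F G M N : B}
    (a : X₁ ⊗ Y ≅ S) (b : X₂ ⊗ Y ≅ S₁) (c : X ⊗ Y₁ ≅ S₂) (d : X ⊗ Y₂ ≅ S₃)
    (m : F ⊗ G ≅ M) (n : F ⊗ G ≅ N) (hX : X₁ = X₂) (hY : Y₁ = Y₂) (hX' : X = X₂) (hY' : Y₁ = Y)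
    (hF : X₁ = F) (hG : Y = G) (hS : S = M) (hS' : S₃ = N) (hS₁ : S₁ = S₂)
    (ham : a.hom ≍ m.hom) (hbc : b.hom ≍ c.hom) (hdn : d.hom ≍ n.hom) :
    (a.inv ≫ eqToHom hX ▷ Y ≫ b.hom) ≫ eqToHom hS₁ ≫ (c.inv ≫ X ◁ eqToHom hY ≫ d.hom) =
      eqToHom hS ≫ (m.inv ≫ n.hom) ≫ eqToHom hS'.symm := by
  subst hX hY hX' hY' hF hG hS hS' hS₁
  obtain rfl := Iso.ext (eq_of_heq ham)
  obtain rfl := Iso.ext (eq_of_heq hbc)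
  obtain rfl := Iso.ext (eq_of_heq hdn)
  simp

theorem conj_whiskerLeft_comp_whiskerRight {X X₁ X₂ Y Y₁ Y₂ S S₁ S₂ S₃ F G M N : B}
    (a : X ⊗ Y₁ ≅ S) (b : X ⊗ Y₂ ≅ S₁) (c : X₁ ⊗ Y ≅ S₂) (d : X₂ ⊗ Y ≅ S₃)
    (m : F ⊗ G ≅ M) (n : F ⊗ G ≅ N) (hY : Y₁ = Y₂) (hX : X₁ = X₂) (hX' : X = X₁) (hY' : Y₂ = Y)
    (hF : X = F) (hG : Y₁ = G) (hS : S = M) (hS' : S₃ = N) (hS₁ : S₁ = S₂)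
    (ham : a.hom ≍ m.hom) (hbc : b.hom ≍ c.hom) (hdn : d.hom ≍ n.hom) :
    (a.inv ≫ X ◁ eqToHom hY ≫ b.hom) ≫ eqToHom hS₁ ≫ (c.inv ≫ eqToHom hX ▷ Y ≫ d.hom) =
      eqToHom hS ≫ (m.inv ≫ n.hom) ≫ eqToHom hS'.symm := by
  subst hX hY hX' hY' hF hG hS hS' hS₁
  obtain rfl := Iso.ext (eq_of_heq ham)
  obtain rfl := Iso.ext (eq_of_heq hbc)
  obtain rfl := Iso.ext (eq_of_heq hdn)
  simp

end Transport

namespace Diagram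

open Letter

variable {B : Type u} [Category.{v} B] [MonoidalCategory B] [BraidedCategory B]

theorem IsCast.inv {X Y : Diagram.{v} B} {f g : X ⟶ Y} {e : f ≅ g} (h : IsCast e.hom) :
    IsCast e.inv := by
  obtain ⟨l, h⟩ := h
  obtain rfl : e = relabelIso l := Iso.ext (cell_ext h)
  exact isCast_relabelIso_inv l

/-- The comparison of the two unit constraints at the unit. -/
def kappa : rightUnit (unit : Diagram.{v} B) ≅ leftUnit unit :=
  plainIso (plain_rightUnit unit) (plain_leftUnit unit)

theorem isCast_kappa : IsCast (kappa (B := B)).hom := isCast_plainIso _ _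

/-- Both sides are built from casts between plain words, whiskered with plain words, so they are
parallel casts. -/
theorem isCanonicalKappa : (weakUnit (B := B)).IsCanonicalKappa kappa := by
  have hα := plain_leftUnit (unit : Diagram.{v} B)
  refine IsCast.eq ((isCast_kappa.tensorCell (isCast_id (𝟙 unit))).whiskerRight_plain hα) ?_
  refine ((isCast_kelly unit unit).whiskerRight_plain hα).comp ((isCast_associator_hom _ _ _).comp
    (IsCast.comp ?_ ((isCast_associator_inv _ _ _).comp
      ((isCast_leftCell unit unit).whiskerRight_plain hα))))
  refine (isCast_leftNaturality (leftUnit unit)).plain_whiskerLeft ?_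
  have h : word (eqToHom (tensorObj_assoc unit unit unit)) =
      strands (B := B) (tensorObj (tensorObj unit unit) unit).size := word_eqToHom _
  exact h ▸ plain_strands _

/-- An endo-arrow of the unit passes from the left-hand strand through the left constraint. -/
def leftStrand (g : (unit : Diagram.{v} B) ⟶ unit) :
    tensorArrow g (𝟙 unit) ≫ leftUnit unit ≅ leftUnit unit ≫ g :=
  whiskerLeftIso (tensorArrow g (𝟙 unit)) kappa.symm ≪≫ rightNaturality g ≪≫
    whiskerRightIso kappa g

/-- Although `g` carries labels, the whiskerings of κ remain casts because both boundaries of κ are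
plain. -/
theorem isCast_leftStrand (g : (unit : Diagram.{v} B) ⟶ unit) : IsCast (leftStrand g).hom :=
  (isCast_kappa.inv.whiskerLeft_of_plain _ (plain_leftUnit unit) (plain_rightUnit unit)).comp
    ((isCast_rightNaturality g).comp
      (isCast_kappa.whiskerRight_of_plain (plain_rightUnit unit) (plain_leftUnit unit) g))

section Exchange

variable (f g : (unit : Diagram.{v} B) ⟶ unit)

theorem right_comp_left :
    tensorArrow (𝟙 unit) f ≫ tensorArrow g (𝟙 unit) = tensorArrow g f := by
  rw [← tensorArrow_comp, id_comp_eq, comp_id_eq]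

theorem left_comp_right :
    tensorArrow g (𝟙 unit) ≫ tensorArrow (𝟙 unit) f = tensorArrow g f := by
  rw [← tensorArrow_comp, id_comp_eq, comp_id_eq]

theorem realize_comp_leftUnit {p q : tensorObj (unit : Diagram.{v} B) unit ⟶ tensorObj unit unit}
    (h : p ≫ q = tensorArrow g f) :
    realize (word (p ≫ q ≫ leftUnit unit)) = realize (word g ++ word f) := by
  rw [← comp_assoc_eq, h]
  exact realize_comp_plain _ (plain_leftUnit unit)

theorem realize_leftUnit_comp :
    realize (word ((leftUnit unit ≫ f) ≫ g)) = realize (word (f ≫ g)) := by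
  rw [comp_assoc_eq]
  exact realize_plain_comp (plain_leftUnit unit) (word (f ≫ g))

/-- Passing through α changes no label, so the comparison of `f ≫ g` is undone and that of `I ⊗ f`
followed by `g ⊗ I` is applied; the latter contains the braiding. -/
theorem val_into_strands :
    val ((leftNaturality f).inv ▷ g ≫ (α_ _ _ _).hom ≫
        tensorArrow (𝟙 unit) f ◁ (leftStrand g).inv) =
      eqToHom (realize_leftUnit_comp f g) ≫
        ((compIso (word f) (word g)).inv ≫ ((β_ (realize (word f)) (realize (word g))) ≪≫
          appendIso (word g) (word f)).hom) ≫
        eqToHom (realize_comp_leftUnit f g (right_comp_left f g)).symm := by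
  obtain ⟨e₁, h₁⟩ := (isCast_leftNaturality f).inv
  obtain ⟨e₂, h₂⟩ := (isCast_leftStrand g).inv
  rw [val_comp, val_comp, val_whiskerLeft, val_whiskerRight, h₁, h₂]
  have hα := plain_leftUnit (unit : Diagram.{v} B)
  exact conj_whiskerRight_comp_whiskerLeft _ _ _ _ _ _ _ _ (realize_comp_plain _ hα).symm
    (realize_plain_comp hα _) (realize_plain_comp hα _) rfl (realize_leftUnit_comp f g)
    (realize_comp_leftUnit f g (right_comp_left f g))
    (congrArg realize (comp_assoc _ _ _)) (plain_comp_compIso hα _ _) (comp_plain_compIso _ hα _)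
    ((compIso_comp_plain _ _ hα).trans (compIso_right_left (word_typed f) (word_typed g)))

/-- The order of the strands is now `g ⊗ I` followed by `I ⊗ f`, whose comparison involves no
braiding, so none is undone on the way out. -/
theorem val_out_of_strands :
    val (tensorArrow g (𝟙 unit) ◁ (leftNaturality f).hom ≫ (α_ _ _ _).inv ≫
        (leftStrand g).hom ▷ f) =
      eqToHom (realize_comp_leftUnit f g (left_comp_right f g)) ≫
        ((appendIso (word g) (word f)).inv ≫ (compIso (word g) (word f)).hom) ≫
        eqToHom (realize_leftUnit_comp g f).symm := by
  obtain ⟨e₁, h₁⟩ := isCast_leftNaturality f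
  obtain ⟨e₂, h₂⟩ := isCast_leftStrand g
  rw [val_comp, val_comp, val_whiskerLeft, val_whiskerRight, h₁, h₂]
  have hα := plain_leftUnit (unit : Diagram.{v} B)
  exact conj_whiskerLeft_comp_whiskerRight _ _ _ _ _ _ _ _ (realize_comp_plain _ hα).symm
    (realize_plain_comp hα _) (realize_append_plain _ (plain_id unit))
    ((realize_comp_plain _ hα).trans (realize_plain_append (plain_id unit) _))
    (realize_comp_leftUnit f g (left_comp_right f g)) (realize_leftUnit_comp g f)
    (congrArg realize (comp_assoc _ _ _).symm)
    ((compIso_comp_plain _ _ hα).trans (compIso_left_right (word_typed f) (word_typed g)))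
    (comp_plain_compIso _ hα _).symm (plain_comp_compIso hα _ _)

theorem left_right_exchange : tensorArrow (𝟙 unit) f ≫ tensorArrow g (𝟙 unit) =
    tensorArrow g (𝟙 unit) ≫ tensorArrow (𝟙 unit) f :=
  (right_comp_left f g).trans (left_comp_right f g).symm

/-- Moving `f` past `g` on the two strands that the left constraint merges. -/
def strandExchange : leftUnit unit ≫ f ≫ g ⟶ leftUnit unit ≫ g ≫ f :=
  (α_ (leftUnit unit) f g).inv ≫
    ((leftNaturality f).inv ▷ g ≫ (α_ _ _ _).hom ≫
      tensorArrow (𝟙 unit) f ◁ (leftStrand g).inv) ≫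
    ((α_ _ _ _).inv ≫ eqToHom (left_right_exchange f g) ▷ leftUnit unit ≫ (α_ _ _ _).hom) ≫
    (tensorArrow g (𝟙 unit) ◁ (leftNaturality f).hom ≫ (α_ _ _ _).inv ≫
      (leftStrand g).hom ▷ f) ≫ (α_ (leftUnit unit) g f).hom

theorem exchange_hom :
    ((weakUnit (B := B)).exchange kappa f g).hom = strandExchange f g := by
  simp only [strandExchange, Category.assoc]
  rfl

theorem val_strandExchange :
    val (strandExchange f g) =
      eqToHom (realize_plain_comp (plain_leftUnit unit) (word (f ≫ g))) ≫
        ((compIso (word f) (word g)).inv ≫ (β_ (realize (word f)) (realize (word g))).hom ≫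
          (compIso (word g) (word f)).hom) ≫
        eqToHom (realize_plain_comp (plain_leftUnit unit) (word (g ≫ f))).symm := by
  -- The strict interchange in the middle is a cast: both orders give the word of `g ⊗ f`.
  obtain ⟨e, hc⟩ := (isCast_associator_inv _ _ _).comp
    (((isCast_eqToHom (left_right_exchange f g)).whiskerRight_plain (plain_leftUnit unit)).comp
      (isCast_associator_hom _ _ _))
  obtain ⟨e₁, h₁⟩ := isCast_associator_inv (leftUnit unit) f g
  obtain ⟨e₂, h₂⟩ := isCast_associator_hom (leftUnit unit) g f
  have split : val (strandExchange f g) = val (α_ (leftUnit unit) f g).inv ≫ val _ ≫ val _ ≫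
    val _ ≫ val (α_ (leftUnit unit) g f).hom := rfl
  rw [split, val_into_strands, val_out_of_strands, hc, h₁, h₂]
  exact eqToHom_conj_comp_conj (realize_congr e₁) (realize_leftUnit_comp f g) _ _ _
    (realize_comp_leftUnit f g (right_comp_left f g)).symm (realize_congr e)
    (realize_comp_leftUnit f g (left_comp_right f g)) _
    (realize_leftUnit_comp g f).symm (realize_congr e₂) _ _

end Exchange

/-! ### The braided equivalence between End(I) and `B` -/

/-- The endo-arrows of the unit realize to objects of `B`. -/
def realization : EndMonoidal (unit : Diagram.{v} B) ⥤ B where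
  obj f := realize (word f)
  map η := val η

/-- Realization turns composition of endo-arrows into the tensor product. -/
def realizationCore : (realization (B := B)).CoreMonoidal where
  εIso := Iso.refl _
  μIso f g := compIso (word f) (word g)
  μIso_hom_natural_left η g := ((compIso _ _).hom_inv_id_assoc _).symm
  μIso_hom_natural_right f η := ((compIso _ _).hom_inv_id_assoc _).symm
  associativity f g h := by
    exact comp_eqToHom_of_heq (congrArg realize (comp_assoc _ _ _))
      (compIso_assoc (word f) (word g) (word h))
  left_unitality f := by
    refine Eq.symm ?_
    refine (congrArg (· ≫ _) (MonoidalCategory.id_whiskerRight _ _)).trans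
      ((Category.id_comp _).trans ?_)
    exact comp_eqToHom_of_heq' (realize_plain_comp (plain_id unit) (word f))
      (plain_compIso (plain_id unit) (word f))
  right_unitality f := by
    refine Eq.symm ?_
    refine (congrArg (· ≫ _) (MonoidalCategory.whiskerLeft_id _ _)).trans
      ((Category.id_comp _).trans ?_)
    exact comp_eqToHom_of_heq' (realize_comp_plain (word f) (plain_id unit))
      (compIso_plain (word f) (plain_id unit))

instance realizationMonoidal : (realization (B := B)).Monoidal := realizationCore.toMonoidal

instance : (realization (B := B)).Faithful where
  map_injective h := cell_ext h

instance : (realization (B := B)).Full where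
  map_surjective φ := ⟨Cell.mk φ, rfl⟩

/-- A single strand labelled by `b`. -/
def labelled (b : B) : (unit : Diagram.{v} B) ⟶ unit :=
  Arrow.mk [Letter.input, Letter.label b, Letter.output] (.input (.label b (.output .nil)))

instance : (realization (B := B)).EssSurj where
  -- The one-label word realizes to `b ⊗ 𝟙_ B`, whence the right unitor.
  mem_essImage b := ⟨labelled b, ⟨MonoidalCategory.rightUnitor b⟩⟩

instance : (realization (B := B)).IsEquivalence where

/-- The 2-cell `f ≫ g ⇒ g ≫ f` underlain by the braiding of `B`. -/
def braidIso (f g : (unit : Diagram.{v} B) ⟶ unit) : f ≫ g ≅ g ≫ f where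
  hom := Cell.mk ((compIso (word f) (word g)).inv ≫
    (β_ (realize (word f)) (realize (word g))).hom ≫ (compIso (word g) (word f)).hom)
  inv := Cell.mk ((compIso (word g) (word f)).inv ≫
    (β_ (realize (word f)) (realize (word g))).inv ≫ (compIso (word f) (word g)).hom)
  hom_inv_id := by
    apply cell_ext
    change ((compIso (word f) (word g)).inv ≫ _ ≫ (compIso (word g) (word f)).hom) ≫
      ((compIso (word g) (word f)).inv ≫ _ ≫ (compIso (word f) (word g)).hom) = 𝟙 _
    simp
  inv_hom_id := by
    apply cell_ext
    change ((compIso (word g) (word f)).inv ≫ _ ≫ (compIso (word f) (word g)).hom) ≫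
      ((compIso (word f) (word g)).inv ≫ _ ≫ (compIso (word g) (word f)).hom) = 𝟙 _
    simp

theorem val_braidIso_hom (f g : (unit : Diagram.{v} B) ⟶ unit) :
    val (braidIso f g).hom = (compIso (word f) (word g)).inv ≫
      (β_ (realize (word f)) (realize (word g))).hom ≫ (compIso (word g) (word f)).hom := rfl

theorem leftUnit_whiskerLeft_braidIso (f g : (unit : Diagram.{v} B) ⟶ unit) :
    leftUnit unit ◁ (braidIso f g).hom = strandExchange f g := by
  apply cell_ext
  rw [val_strandExchange, val_plain_whiskerLeft (plain_leftUnit unit), val_braidIso_hom]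
  rfl

/-- Since realization is faithful and monoidal, the braiding axioms are inherited from `B`. -/
instance endBraided : BraidedCategory (EndMonoidal (unit : Diagram.{v} B)) :=
  .ofFaithful realization braidIso fun f g => (compIso (word f) (word g)).hom_inv_id_assoc _

theorem isCanonicalBraiding : (weakUnit (B := B)).IsCanonicalBraiding endBraided :=
  ⟨kappa, isCanonicalKappa, fun f g =>
    (leftUnit_whiskerLeft_braidIso f g).trans (exchange_hom f g).symm⟩

instance realizationBraided : (realization (B := B)).Braided where
  braided f g := (compIso (word f) (word g)).hom_inv_id_assoc _

theorem exists_braided_equivalence : ∃ F : B ⥤ EndMonoidal (unit : Diagram.{v} B),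
    F.IsEquivalence ∧ Nonempty F.Braided := by
  let e := (realization (B := B)).asEquivalence
  have : e.functor.Braided := realizationBraided
  exact ⟨e.inverse, inferInstance, e.nonempty_braided_inverse⟩

end Diagram

theorem theorem7p1 (B : Type u) [Category.{v} B] [MonoidalCategory B] [BraidedCategory B] :
    ∃ (C : Type (max u v)) (_ : Bicategory.{v, max u v} C) (_ : Bicategory.Strict C)
      (T : StrictTensor C) (W : WeakUnit T) (β : BraidedCategory (EndMonoidal W.unit)),
      W.IsCanonicalBraiding β ∧
        ∃ F : B ⥤ EndMonoidal W.unit, F.IsEquivalence ∧ Nonempty F.Braided :=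
  ⟨Diagram.{v} B, Diagram.bicategory, Diagram.strict, Diagram.tensor, Diagram.weakUnit,
    Diagram.endBraided, Diagram.isCanonicalBraiding,
    Diagram.exists_braided_equivalence⟩
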